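/- Let $\beta,\gamma,\epsilon$ be real parameters and set $\kappa=\frac14[8(1+\gamma)-4\beta+3\epsilon]$. For a mass parameter $m>0$ consider the static, spherically symmetric metric, in isotropic coordinates $(x^0,\boldsymbol x)$, $r=|\boldsymbol x|$, $$ds^2=\mathcal A(r)(dx^0)^2-\frac{1}{\mathcal B(r)}\delta_{ij}dx^idx^j,\qquad \mathcal A(r)=1-\frac{2m}{r}+2\beta\frac{m^2}{r^2}+\cdots,\qquad \frac1{\mathcal B(r)}=1+2\gamma\frac mr+\frac32\epsilon\frac{m^2}{r^2}+\cdots,$$ where both series are power series in $m/r$ with coefficients independent of $m$. Let $r_h>0$ and $m_0>0$ be such that for every $0<m<m_0$ both series converge and have positive sums for all $r>r_h$. Let $\boldsymbol N_e$ be a unit vector and $\boldsymbol x_B$ a point, with $r_B=|\boldsymbol x_B|$ and $\boldsymbol n_B=\boldsymbol x_B/r_B$, such that the half-line $\{\boldsymbol x_B+s\boldsymbol N_e: s\le 0\}$ is contained in the region $r>r_h$ and such that $\boldsymbol N_e\times\boldsymbol n_B\neq 0$. Let $r_c=r_B|\boldsymbol N_e\times\boldsymbol n_B|$. A quasi-Minkowskian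 light ray emitted at infinity in the direction $\boldsymbol N_e$ and received at $\boldsymbol x_B$ is, for each $0<m<m_0$, a null geodesic lying in $r>r_h$, with affine parameter $\sigma\in(-\infty,\sigma_B]$ and parametric equations given by convergent series $$x^0=x^0_B+\sigma-\sigma_B+\sum_{n\ge1}m^nX^0_{(n)}(\sigma),\qquad \boldsymbol x=\boldsymbol x_B+(\sigma-\sigma_B)\boldsymbol N_e+\sum_{n\ge1}m^n\boldsymbol X_{(n)}(\sigma),$$ where the $X^0_{(n)},\boldsymbol X_{(n)}$ do not depend on $m$ and vanish at $\sigma=\sigma_B$, and which comes from infinity asymptotically to a straight line parallel to $\boldsymbol N_e$: as $\sigma\to-\infty$, $\boldsymbol x\cdot\boldsymbol N_e\to-\infty$ and $\boldsymbol x-(\boldsymbol x\cdot\boldsymbol N_e)\boldsymbol N_e$ converges. With $l_\alpha=g_{\alpha\beta}\,dx^\beta/d\sigma$ and $\widehat{\boldsymbol l}=(l_i/l_0)$, its angular momentum is $\boldsymbol L=-\boldsymbol x\times\widehat{\boldsymbol l}$, and its impact parameter is $b=|\boldsymbol L|$. For such a ray and every $0<m<m_0$, $\boldsymbol L$ is constant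 along the ray, and $$b=r_c\left\{1+\frac{(1+\gamma)m}{r_c}\frac{|\boldsymbol N_e\times\boldsymbol n_B|}{1-\boldsymbol N_e\cdot\boldsymbol n_B}+\frac{m^2}{r_c^2}\left\{\kappa\left[1+\frac{\pi-\arccos(\boldsymbol N_e\cdot\boldsymbol n_B)}{|\boldsymbol N_e\times\boldsymbol n_B|}\boldsymbol N_e\cdot\boldsymbol n_B\right]-(1+\gamma)^2\frac{1+\boldsymbol N_e\cdot\boldsymbol n_B}{1-\boldsymbol N_e\cdot\boldsymbol n_B}\right\}\right\}+O\!\left(\frac{m^3}{r_c^2}\right),$$ where the remainder is bounded by $C\,m^3/r_c^2$ whenever $m\le\delta\, r_c$, with $C$ and $\delta>0$ depending only on the coefficients of the two series and on $\boldsymbol N_e\cdot\boldsymbol n_B$. Moreover, with the remainder omitted, this expression is the limit, as the point $\boldsymbol x_A$ recedes along the ray to infinity ($\sigma\to-\infty$), of the finite-distance expression $$\bar r_c\left\{1+\frac{(1+\gamma)m}{\bar r_c}\frac{|\boldsymbol N\times\boldsymbol n_A|+|\boldsymbol N\times\boldsymbol n_B|}{1+\boldsymbol n_A\cdot\boldsymbol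 n_B}+\frac{m^2}{\bar r_c^2}\left\{\kappa\left[1-\frac{\arccos(\boldsymbol n_A\cdot\boldsymbol n_B)}{|\boldsymbol n_A\times\boldsymbol n_B|}(\boldsymbol N\cdot\boldsymbol n_A)(\boldsymbol N\cdot\boldsymbol n_B)\right]-(1+\gamma)^2\frac{1-(\boldsymbol N\cdot\boldsymbol n_A)(\boldsymbol N\cdot\boldsymbol n_B)}{1+\boldsymbol n_A\cdot\boldsymbol n_B}\right\}\right\},$$ where $r_A=|\boldsymbol x_A|$, $\boldsymbol n_A=\boldsymbol x_A/r_A$, $\boldsymbol N=(\boldsymbol x_B-\boldsymbol x_A)/|\boldsymbol x_B-\boldsymbol x_A|$ and $\bar r_c=r_Ar_B|\boldsymbol n_A\times\boldsymbol n_B|/|\boldsymbol x_B-\boldsymbol x_A|$. -/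

import Mathlib

open Set Filter Topology

/-- Ordered triples, regarded as vectors of the Euclidean space. -/
abbrev E3 : Type := EuclideanSpace ℝ (Fin 3)

noncomputable section

/-- The exterior (vector) product of two triples. -/
def cross (u v : E3) : E3 := WithLp.toLp 2 (crossProduct u.ofLp v.ofLp)

/-- The unit vector `x / |x|`. -/
def unitDir (x : E3) : E3 := (‖x‖)⁻¹ • x

/-- The coefficients of the expansions in powers of `m / r` of the two potentials of the metric
`ds² = A(r) (dx⁰)² - (1 / B(r)) δᵢⱼ dxⁱ dxʲ`:
`A(r) = 1 - 2 m/r + 2 β m²/r² + ⋯` and `1 / B(r) = 1 + 2 γ m/r + (3/2) ε m²/r² + ⋯`.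
The higher coefficients are arbitrary. -/
structure PotentialExpansion where
  β : ℝ
  γ : ℝ
  ε : ℝ
  a : ℕ → ℝ
  e : ℕ → ℝ
  a_zero : a 0 = 1
  a_one : a 1 = -2
  a_two : a 2 = 2 * β
  e_zero : e 0 = 1
  e_one : e 1 = 2 * γ
  e_two : e 2 = 3 / 2 * ε

namespace PotentialExpansion

/-- The potential `A(r)`. -/
def potA (P : PotentialExpansion) (m r : ℝ) : ℝ := ∑' n : ℕ, P.a n * (m / r) ^ n

/-- The potential `1 / B(r)`. -/
def invB (P : PotentialExpansion) (m r : ℝ) : ℝ := ∑' n : ℕ, P.e n * (m / r) ^ n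

/-- `κ = (8 (1 + γ) - 4 β + 3 ε) / 4`. -/
def kappa (P : PotentialExpansion) : ℝ := (8 * (1 + P.γ) - 4 * P.β + 3 * P.ε) / 4

/-- The metric of mass parameter `m` is regular in the region `r > r_h`: both expansions converge
there and the metric is nondegenerate, of signature `+ - - -`. -/
def RegularOutside (P : PotentialExpansion) (m rh : ℝ) : Prop :=
  ∀ r : ℝ, rh < r →
    Summable (fun n : ℕ => P.a n * (m / r) ^ n) ∧ Summable (fun n : ℕ => P.e n * (m / r) ^ n) ∧
      0 < P.potA m r ∧ 0 < P.invB m r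

/-- `σ ↦ (t σ, x σ) = (x⁰, 𝐱)`, `σ` in the interval `I`, is an affinely parametrized null geodesic.
With `l₀ = A dx⁰/dσ` and `lᵢ = -(1/B) dxⁱ/dσ`, the equations are the Euler-Lagrange equations
`dl₀/dσ = 0`, `dlᵢ/dσ = (1/2) [A'(r) (dx⁰/dσ)² - (1/B)'(r) |d𝐱/dσ|²] xⁱ / r`
of the Lagrangian `(1/2) g_{μν} (dx^μ/dσ) (dx^ν/dσ)`.
Derivatives are one-sided at an endpoint of `I`. -/
structure IsNullGeodesicOn (P : PotentialExpansion) (m : ℝ) (I : Set ℝ)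
    (t : ℝ → ℝ) (x : ℝ → E3) : Prop where
  differentiable_time : DifferentiableOn ℝ t I
  differentiable_pos : DifferentiableOn ℝ x I
  tangent_ne_zero : ∀ σ ∈ I, derivWithin t I σ ≠ 0 ∨ derivWithin x I σ ≠ 0
  null : ∀ σ ∈ I,
    P.potA m ‖x σ‖ * derivWithin t I σ ^ 2 - P.invB m ‖x σ‖ * ‖derivWithin x I σ‖ ^ 2 = 0
  eq_time : ∀ σ ∈ I,
    HasDerivWithinAt (fun s => P.potA m ‖x s‖ * derivWithin t I s) 0 I σ
  eq_space : ∀ σ ∈ I,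
    HasDerivWithinAt (fun s => -(P.invB m ‖x s‖ • derivWithin x I s))
      ((1 / 2 * (deriv (P.potA m) ‖x σ‖ * derivWithin t I σ ^ 2
          - deriv (P.invB m) ‖x σ‖ * ‖derivWithin x I σ‖ ^ 2) / ‖x σ‖) • x σ) I σ

/-- The direction triple `(lᵢ / l₀)` of the path `(t, x)` at the parameter `σ`. -/
def directionTriple (P : PotentialExpansion) (m : ℝ) (I : Set ℝ)
    (t : ℝ → ℝ) (x : ℝ → E3) (σ : ℝ) : E3 :=
  (P.potA m ‖x σ‖ * derivWithin t I σ)⁻¹ • (-(P.invB m ‖x σ‖ • derivWithin x I σ))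

/-- The angular momentum `𝐋 = -𝐱 × (lᵢ / l₀)`. -/
def angularMomentum (P : PotentialExpansion) (m : ℝ) (I : Set ℝ)
    (t : ℝ → ℝ) (x : ℝ → E3) (σ : ℝ) : E3 :=
  -cross (x σ) (P.directionTriple m I t x σ)

/-- A quasi-Minkowskian light ray emitted at infinity in the direction `Ne` and received at `xB`:
for each mass parameter `0 < m < m₀` it is a null geodesic in the region `r > r_h`, and its
parametric equations are convergent power series in `m` whose term of order zero is the Minkowskian
ray. The coefficients `coefTime n`, `coefPos n` are those of `m ^ (n + 1)`; they do not depend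
on `m`. The ray comes from infinity, asymptotically to a straight line parallel to `Ne`. -/
structure QuasiMinkowskianRay (P : PotentialExpansion) (rh m₀ : ℝ) (Ne xB : E3) where
  σB : ℝ
  tB : ℝ
  time : ℝ → ℝ → ℝ
  pos : ℝ → ℝ → E3
  coefTime : ℕ → ℝ → ℝ
  coefPos : ℕ → ℝ → E3
  coefTime_σB : ∀ n, coefTime n σB = 0
  coefPos_σB : ∀ n, coefPos n σB = 0
  hasSum_time : ∀ m ∈ Ioo 0 m₀, ∀ σ ∈ Iic σB,
    HasSum (fun n : ℕ => m ^ (n + 1) * coefTime n σ) (time m σ - (tB + (σ - σB)))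
  hasSum_pos : ∀ m ∈ Ioo 0 m₀, ∀ σ ∈ Iic σB,
    HasSum (fun n : ℕ => m ^ (n + 1) • coefPos n σ) (pos m σ - (xB + (σ - σB) • Ne))
  mem_region : ∀ m ∈ Ioo 0 m₀, ∀ σ ∈ Iic σB, rh < ‖pos m σ‖
  isNullGeodesic : ∀ m ∈ Ioo 0 m₀, P.IsNullGeodesicOn m (Iic σB) (time m) (pos m)
  from_infinity : ∀ m ∈ Ioo 0 m₀, Tendsto (fun σ => inner ℝ (pos m σ) Ne) atBot atBot
  asymptote : ∀ m ∈ Ioo 0 m₀,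
    ∃ p : E3, Tendsto (fun σ => pos m σ - inner ℝ (pos m σ) Ne • Ne) atBot (𝓝 p)

/-- The angular momentum of the ray at the parameter `σ`, for the mass parameter `m`. -/
def QuasiMinkowskianRay.L {P : PotentialExpansion} {rh m₀ : ℝ} {Ne xB : E3}
    (Γ : QuasiMinkowskianRay P rh m₀ Ne xB) (m σ : ℝ) : E3 :=
  P.angularMomentum m (Iic Γ.σB) (Γ.time m) (Γ.pos m) σ

/-- The impact parameter: the magnitude of the (conserved) angular momentum, here evaluated at the
point of reception. -/
def QuasiMinkowskianRay.impactParameter {P : PotentialExpansion} {rh m₀ : ℝ} {Ne xB : E3}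
    (Γ : QuasiMinkowskianRay P rh m₀ Ne xB) (m : ℝ) : ℝ :=
  ‖Γ.L m Γ.σB‖

/-- The zeroth-order distance of closest approach `r_c = r_B |Ne × n_B|`. -/
def rcInfinity (Ne xB : E3) : ℝ := ‖xB‖ * ‖cross Ne (unitDir xB)‖

/-- The second-order expression of the impact parameter of a ray emitted at infinity. -/
def impactInfinity (P : PotentialExpansion) (m : ℝ) (Ne xB : E3) : ℝ :=
  let nB := unitDir xB
  let rc := rcInfinity Ne xB
  rc * (1 + (1 + P.γ) * m / rc * (‖cross Ne nB‖ / (1 - inner ℝ Ne nB))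
    + m ^ 2 / rc ^ 2 *
      (P.kappa * (1 + (Real.pi - Real.arccos (inner ℝ Ne nB)) / ‖cross Ne nB‖ * inner ℝ Ne nB)
        - (1 + P.γ) ^ 2 * ((1 + inner ℝ Ne nB) / (1 - inner ℝ Ne nB))))

/-- The second-order expression of the impact parameter of a ray joining two points `xA` and `xB` at
finite distance. -/
def impactFinite (P : PotentialExpansion) (m : ℝ) (xA xB : E3) : ℝ :=
  let nA := unitDir xA
  let nB := unitDir xB
  let N := unitDir (xB - xA)
  let rc := ‖xA‖ * ‖xB‖ * ‖cross nA nB‖ / ‖xB - xA‖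
  rc * (1 + (1 + P.γ) * m / rc * ((‖cross N nA‖ + ‖cross N nB‖) / (1 + inner ℝ nA nB))
    + m ^ 2 / rc ^ 2 *
      (P.kappa * (1 - Real.arccos (inner ℝ nA nB) / ‖cross nA nB‖
          * (inner ℝ N nA * inner ℝ N nB))
        - (1 + P.γ) ^ 2 * ((1 - inner ℝ N nA * inner ℝ N nB) / (1 + inner ℝ nA nB))))

end PotentialExpansion

end

/-! Divide the spatial momentum of the ray by the conserved energy. The ray becomes a motion in a
central field with `|p|² = n²(m/r)`, where `n² = B⁻¹ / A`. Hence `x × p` is conserved, and its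
length is the impact parameter `b`. With `U = b/r`, `w = m/b` and `H` the derivative of `n²`, the
orbit obeys `U'' + U = w H(w U) / 2` in the polar angle. Here `H(v) = 2(1+γ) + 4κv + O(v²)`, so this
is an oscillator with a constant forcing of order `w` and a resonant one of order `w²`.

A ray from infinity starts with `U → 0`, `U' → 1` and direction `n → -Ne`. It therefore sweeps the
angle `π - θ`, where `θ = arccos (Ne · n_B)`. Perturbation theory up to `w²` gives `b / r_B` at
reception as a polynomial in `m/b`, with a cubic error (`IsOrbitOn.second_order`,
`IsOrbitOn.closing`). Inverting this relation (`inversion_bound`) expresses `b` through `m / r_c`.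
The resonant terms produce the `arccos` in the formula, and the inversion produces the term in
`(1+γ)²`.

Two points need care. The asymptotics give only the cosine of the swept angle. A full extra turn is
excluded because the first order solution would make `U` negative just after the angle `π`. Moreover
the expansion needs `m/b` small, whereas only `m/r_c` is assumed small. Since the ray is a power
series in `m`, `m/b` is continuous in `m` and vanishes at `m = 0`, so a bootstrap works
(`exists_continuousOn_ratio`, `exists_impact_estimate`).

The limit of the finite-distance formula is independent of all this: it follows from `n_A → -Ne`, `N
→ Ne` and `r_A / |x_B - x_A| → 1`. -/

/-! ### Power series in `m / r` -/

/-- The sum of the power series with coefficients `c`. -/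
noncomputable def powerSum (c : ℕ → ℝ) (w : ℝ) : ℝ := ∑' n : ℕ, c n * w ^ n

theorem powerSum_zero (c : ℕ → ℝ) : powerSum c 0 = c 0 := by
  unfold powerSum
  rw [tsum_eq_single 0]
  · simp
  · intro n hn; simp [hn]

/-- Summability at a positive `v` bounds the terms there, so the radius of convergence is at least
`v`. Information on positive arguments alone thus yields analyticity on both sides of the origin,
and at the origin itself. -/
theorem powerSum_analyticAt {c : ℕ → ℝ} {R : ℝ}
    (h : ∀ w ∈ Ioo 0 R, Summable fun n : ℕ => c n * w ^ n) {w : ℝ} (hw : |w| < R) :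
    AnalyticAt ℝ (powerSum c) w := by
  obtain ⟨v, hv1, hv2⟩ := exists_between hw
  have hv0 : 0 < v := lt_of_le_of_lt (abs_nonneg _) hv1
  set p := FormalMultilinearSeries.ofScalars ℝ c
  have hr : ENNReal.ofReal v ≤ p.radius := by
    refine p.le_radius_of_tendsto (r := v.toNNReal) (l := 0) ?_
    have h1 := (h v ⟨hv0, hv2⟩).tendsto_atTop_zero.norm
    simp only [norm_zero] at h1
    refine h1.congr fun n => ?_
    rw [norm_mul, norm_pow, Real.coe_toNNReal _ hv0.le, Real.norm_of_nonneg hv0.le]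
    simp [p]
  have hpos : 0 < p.radius := lt_of_lt_of_le (by simpa using hv0) hr
  have hs := (p.hasFPowerSeriesOnBall hpos).analyticAt_of_mem (y := w) (by
    rw [Metric.mem_eball, edist_zero_right]
    refine lt_of_lt_of_le ?_ hr
    rw [← ofReal_norm, Real.norm_eq_abs]
    exact (ENNReal.ofReal_lt_ofReal_iff hv0).2 hv1)
  refine hs.congr (Eventually.of_forall fun y => ?_)
  have := FormalMultilinearSeries.ofScalars_sum_eq c y
  simp only [FormalMultilinearSeries.ofScalarsSum] at this
  rw [powerSum]
  simpa [p, smul_eq_mul] using this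

theorem summable_of_abs_lt {c : ℕ → ℝ} {v w : ℝ} (h : Summable fun n : ℕ => c n * v ^ n)
    (hw : |w| < v) : Summable fun n : ℕ => ‖c n * w ^ n‖ := by
  have hv : 0 < v := lt_of_le_of_lt (abs_nonneg _) hw
  have h1 := (h.tendsto_atTop_zero.norm).bddAbove_range
  obtain ⟨M, hM⟩ := h1
  refine Summable.of_nonneg_of_le (fun n => norm_nonneg _) (fun n => ?_)
    ((summable_geometric_of_lt_one (r := |w| / v) (by positivity)
      ((div_lt_one hv).2 hw)).mul_left M)
  have := hM ⟨n, rfl⟩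
  simp only [norm_mul, norm_pow, Real.norm_eq_abs, abs_of_pos hv] at this ⊢
  rw [div_pow, mul_div_assoc', le_div_iff₀ (by positivity)]
  have := mul_le_mul_of_nonneg_right this (pow_nonneg (abs_nonneg w) n)
  linarith

/-- Second order expansion of a power series, with a remainder that is analytic at the origin. -/
theorem powerSum_expand {c : ℕ → ℝ} {R : ℝ}
    (h : ∀ w ∈ Ioo 0 R, Summable fun n : ℕ => c n * w ^ n) {w : ℝ} (hw : |w| < R) :
    powerSum c w = c 0 + c 1 * w + c 2 * w ^ 2 + w ^ 3 * powerSum (fun n => c (n + 3)) w := by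
  obtain ⟨v, hv1, hv2⟩ := exists_between hw
  have hs := (summable_of_abs_lt (h v ⟨lt_of_le_of_lt (abs_nonneg _) hv1, hv2⟩) hv1).of_norm
  rw [powerSum, ← hs.sum_add_tsum_nat_add 3, powerSum, ← tsum_mul_left]
  simp only [Finset.sum_range_succ, Finset.sum_range_zero]
  congr 1
  · ring
  · exact tsum_congr fun n => by ring

theorem summable_shift {c : ℕ → ℝ} {w : ℝ} (h : Summable fun n : ℕ => c n * w ^ n) (hw : w ≠ 0) :
    Summable fun n : ℕ => c (n + 3) * w ^ n := by
  have h1 := ((summable_nat_add_iff 3).2 h).mul_left (w ^ 3)⁻¹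
  refine h1.congr fun n => ?_
  field_simp
  ring

/-! ### The exterior product -/

theorem norm_cross_sq (u v : E3) : ‖cross u v‖ ^ 2 = ‖u‖ ^ 2 * ‖v‖ ^ 2 - inner ℝ u v ^ 2 := by
  simp only [EuclideanSpace.real_norm_sq_eq, cross, Fin.sum_univ_three, cross_apply,
    PiLp.inner_apply, RCLike.inner_apply, conj_trivial]
  simp
  ring

/-- The exterior product as a continuous bilinear map. -/
noncomputable def crossL : E3 →L[ℝ] E3 →L[ℝ] E3 :=
  LinearMap.toContinuousLinearMap
    ((LinearMap.toContinuousLinearMap : (E3 →ₗ[ℝ] E3) ≃ₗ[ℝ] (E3 →L[ℝ] E3)).toLinearMap ∘ₗ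
      (LinearMap.mk₂ ℝ cross
        (fun a b c => by ext i; simp [cross])
        (fun a b c => by ext i; simp [cross])
        (fun a b c => by ext i; simp [cross])
        (fun a b c => by ext i; simp [cross])))

theorem crossL_apply (u v : E3) : crossL u v = cross u v := rfl

theorem cross_self_eq_zero (u : E3) : cross u u = 0 := by
  ext i; simp [cross]

theorem cross_smul_right (c : ℝ) (u v : E3) : cross u (c • v) = c • cross u v := by
  rw [← crossL_apply, map_smul, crossL_apply]

theorem cross_smul_left (c : ℝ) (u v : E3) : cross (c • u) v = c • cross u v := by
  rw [← crossL_apply, map_smul]; rfl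

theorem continuous_cross : Continuous fun q : E3 × E3 => cross q.1 q.2 :=
  crossL.isBoundedBilinearMap.continuous

/-! ### Comparison lemmas and the forced oscillator -/

/-- A function with zero derivative on a half-line is constant. -/
theorem eq_of_hasDerivWithinAt_zero {V : Type*} [NormedAddCommGroup V] [NormedSpace ℝ V]
    {f : ℝ → V} {b : ℝ} (h : ∀ s ∈ Iic b, HasDerivWithinAt f 0 (Iic b) s) {s : ℝ} (hs : s ≤ b) :
    f s = f b := by
  have := (convex_Iic b).norm_image_sub_le_of_norm_hasDerivWithin_le (C := 0) h
    (fun x _ => by simp) (show b ∈ Iic b from le_refl b) (show s ∈ Iic b from hs)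
  rw [zero_mul, norm_le_zero_iff, sub_eq_zero] at this
  exact this

/-- A mean value inequality with a variable bound. Taking `f = 0` turns it into a monotonicity
criterion for `g`. -/
theorem abs_sub_le_sub_of_deriv_le {s t : ℝ} (hst : s ≤ t) {f f' g g' : ℝ → ℝ}
    (hf : ∀ σ ∈ Icc s t, HasDerivWithinAt f (f' σ) (Icc s t) σ)
    (hg : ∀ σ ∈ Icc s t, HasDerivWithinAt g (g' σ) (Icc s t) σ)
    (h : ∀ σ ∈ Icc s t, |f' σ| ≤ g' σ) : |f t - f s| ≤ g t - g s := by
  have key := image_norm_le_of_norm_deriv_right_le_deriv_boundary'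
    (f := fun σ => f σ - f s) (f' := f') (a := s) (b := t)
    (fun σ hσ => ((hf σ hσ).sub_const _).continuousWithinAt)
    (fun σ hσ => ((hf σ (Ico_subset_Icc_self hσ)).sub_const _).mono_of_mem_nhdsWithin
      (Icc_mem_nhdsGE_of_mem hσ))
    (B := fun σ => g σ - g s) (B' := g') (by simp)
    (fun σ hσ => ((hg σ hσ).sub_const _).continuousWithinAt)
    (fun σ hσ => ((hg σ (Ico_subset_Icc_self hσ)).sub_const _).mono_of_mem_nhdsWithin
      (Icc_mem_nhdsGE_of_mem hσ))
    (fun σ hσ => h σ (Ico_subset_Icc_self hσ))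
  exact key (right_mem_Icc.2 hst)

/-- A forced oscillator starting at rest, in an arbitrary parametrization. -/
theorem oscillator_bound {s t : ℝ} (hst : s ≤ t) {D W φ ω R : ℝ → ℝ} {ρ : ℝ}
    (hω : ∀ σ ∈ Icc s t, 0 ≤ ω σ)
    (hφ : ∀ σ ∈ Icc s t, HasDerivWithinAt φ (ω σ) (Icc s t) σ)
    (hD : ∀ σ ∈ Icc s t, HasDerivWithinAt D (ω σ * W σ) (Icc s t) σ)
    (hW : ∀ σ ∈ Icc s t, HasDerivWithinAt W (ω σ * (-D σ + R σ)) (Icc s t) σ)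
    (hR : ∀ σ ∈ Icc s t, |R σ| ≤ ρ) (hD0 : D s = 0) (hW0 : W s = 0) :
    |D t| ≤ 2 * ρ * (φ t - φ s) := by
  have hg : ∀ σ ∈ Icc s t, HasDerivWithinAt (fun σ => ρ * φ σ) (ρ * ω σ) (Icc s t) σ :=
    fun σ hσ => (hφ σ hσ).const_mul ρ
  -- Variation of constants: in the frame rotating with `φ` the homogeneous terms cancel and each
  -- component is driven by `R` alone. The two components account for the factor 2 in the bound.
  have h1 := abs_sub_le_sub_of_deriv_le hst
    (f := fun σ => D σ * Real.cos (φ σ) - W σ * Real.sin (φ σ))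
    (f' := fun σ => -(ω σ * R σ * Real.sin (φ σ)))
    (fun σ hσ => by
      have := ((hD σ hσ).mul ((hφ σ hσ).cos)).sub ((hW σ hσ).mul ((hφ σ hσ).sin))
      exact this.congr_deriv (by ring)) hg
    (fun σ hσ => by
      rw [abs_neg, abs_mul, abs_mul, abs_of_nonneg (hω σ hσ)]
      have := mul_le_mul (hR σ hσ) (Real.abs_sin_le_one (φ σ)) (abs_nonneg _)
        ((abs_nonneg _).trans (hR σ hσ))
      nlinarith [mul_le_mul_of_nonneg_left this (hω σ hσ)])
  have h2 := abs_sub_le_sub_of_deriv_le hst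
    (f := fun σ => D σ * Real.sin (φ σ) + W σ * Real.cos (φ σ))
    (f' := fun σ => ω σ * R σ * Real.cos (φ σ))
    (fun σ hσ => by
      have := ((hD σ hσ).mul ((hφ σ hσ).sin)).add ((hW σ hσ).mul ((hφ σ hσ).cos))
      exact this.congr_deriv (by ring)) hg
    (fun σ hσ => by
      rw [abs_mul, abs_mul, abs_of_nonneg (hω σ hσ)]
      have := mul_le_mul (hR σ hσ) (Real.abs_cos_le_one (φ σ)) (abs_nonneg _)
        ((abs_nonneg _).trans (hR σ hσ))
      nlinarith [mul_le_mul_of_nonneg_left this (hω σ hσ)])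
  simp only [hD0, hW0, zero_mul, sub_zero, add_zero] at h1 h2
  have e : D t = (D t * Real.cos (φ t) - W t * Real.sin (φ t)) * Real.cos (φ t)
      + (D t * Real.sin (φ t) + W t * Real.cos (φ t)) * Real.sin (φ t) := by
    linear_combination (-D t) * Real.sin_sq_add_cos_sq (φ t)
  rw [e]
  have h3 := mul_le_mul h1 (Real.abs_cos_le_one (φ t)) (abs_nonneg _) ((abs_nonneg _).trans h1)
  have h4 := mul_le_mul h2 (Real.abs_sin_le_one (φ t)) (abs_nonneg _) ((abs_nonneg _).trans h2)
  rw [← abs_mul] at h3 h4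
  refine (abs_add_le _ _).trans ?_
  linarith

/-! ### Perturbation of the orbit equation -/

/-- The orbit equation `U'' + U = w H (w U) / 2` in the polar angle `φ`, for an arbitrary
parametrization of the orbit by `σ`, with `φ' = ω` and `U' = ω V`. -/
structure IsOrbitOn (H : ℝ → ℝ) (w : ℝ) (I : Set ℝ) (U V φ ω : ℝ → ℝ) : Prop where
  pos : ∀ σ ∈ I, 0 < U σ
  rate : ∀ σ ∈ I, 0 ≤ ω σ
  angle : ∀ σ ∈ I, HasDerivWithinAt φ (ω σ) I σ
  deriv_U : ∀ σ ∈ I, HasDerivWithinAt U (ω σ * V σ) I σ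
  deriv_V : ∀ σ ∈ I, HasDerivWithinAt V (ω σ * (-U σ + w * H (w * U σ) / 2)) I σ

namespace IsOrbitOn

variable {H : ℝ → ℝ} {w : ℝ} {I : Set ℝ} {U V φ ω : ℝ → ℝ}

theorem mono {J : Set ℝ} (h : IsOrbitOn H w I U V φ ω) (hJ : J ⊆ I) :
    IsOrbitOn H w J U V φ ω where
  pos σ hσ := h.pos σ (hJ hσ)
  rate σ hσ := h.rate σ (hJ hσ)
  angle σ hσ := (h.angle σ (hJ hσ)).mono hJ
  deriv_U σ hσ := (h.deriv_U σ (hJ hσ)).mono hJ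
  deriv_V σ hσ := (h.deriv_V σ (hJ hσ)).mono hJ

theorem angle_mono {s t : ℝ} (hst : s ≤ t) (h : IsOrbitOn H w (Icc s t) U V φ ω) :
    φ s ≤ φ t := by
  have := abs_sub_le_sub_of_deriv_le hst (f := fun _ => 0) (f' := fun _ => 0)
    (fun σ _ => hasDerivWithinAt_const _ _ _) h.angle (fun σ hσ => by simpa using h.rate σ hσ)
  have h0 := (abs_nonneg _).trans this
  linarith

/-- The difference from the free solution with the same initial data is an oscillator at rest,
driven by `w H(w U) / 2`, which is at most `w M`. -/
theorem first_order {s t M : ℝ} (hst : s ≤ t) (h : IsOrbitOn H w (Icc s t) U V φ ω)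
    (hw : 0 ≤ w) (hM : ∀ σ ∈ Icc s t, |H (w * U σ)| ≤ 2 * M) :
    |U t - (U s * Real.cos (φ t - φ s) + V s * Real.sin (φ t - φ s))|
      ≤ 2 * (w * M) * (φ t - φ s) := by
  refine oscillator_bound hst (R := fun σ => w * H (w * U σ) / 2) (φ := φ)
    (W := fun σ => V σ - (-(U s * Real.sin (φ σ - φ s)) + V s * Real.cos (φ σ - φ s)))
    (D := fun σ => U σ - (U s * Real.cos (φ σ - φ s) + V s * Real.sin (φ σ - φ s)))
    h.rate h.angle (fun σ hσ => ?_) (fun σ hσ => ?_) (fun σ hσ => ?_) (by simp) (by simp)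
  · have hψ := (h.angle σ hσ).sub_const (φ s)
    exact ((h.deriv_U σ hσ).sub ((hψ.cos.const_mul (U s)).add (hψ.sin.const_mul (V s)))).congr_deriv
      (by ring)
  · have hψ := (h.angle σ hσ).sub_const (φ s)
    exact ((h.deriv_V σ hσ).sub
      ((hψ.sin.const_mul (U s)).neg.add (hψ.cos.const_mul (V s)))).congr_deriv (by ring)
  · rw [abs_div, abs_mul, abs_of_nonneg hw, abs_two, div_le_iff₀ two_pos]
    have := mul_le_mul_of_nonneg_left (hM σ hσ) hw
    linarith

/-- The forcing is close to `g w + 2 κ w² U`, and `U` may be replaced there by the free solution at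
a cost given by `first_order`. The resulting linear problem is solved explicitly: the constant
forcing gives `1 - cos`. The resonant forcings `2 cos` and `2 sin` give `ψ sin ψ` and `sin ψ - ψ cos
ψ`. -/
theorem second_order {s t M g κ K Q : ℝ} (hst : s ≤ t) (h : IsOrbitOn H w (Icc s t) U V φ ω)
    (hw : 0 ≤ w) (hM0 : 0 ≤ M) (hM : ∀ σ ∈ Icc s t, |H (w * U σ)| ≤ 2 * M) (hK0 : 0 ≤ K)
    (hK : ∀ σ ∈ Icc s t, |H (w * U σ) - 2 * g - 4 * κ * (w * U σ)| ≤ K * (w * U σ) ^ 2)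
    (hU : ∀ σ ∈ Icc s t, U σ ≤ 2) (hQ : φ t - φ s ≤ Q) :
    |U t - (U s * Real.cos (φ t - φ s) + V s * Real.sin (φ t - φ s)
        + g * w * (1 - Real.cos (φ t - φ s))
        + κ * w ^ 2 * (U s * ((φ t - φ s) * Real.sin (φ t - φ s))
          + V s * (Real.sin (φ t - φ s) - (φ t - φ s) * Real.cos (φ t - φ s))))|
      ≤ 2 * Q * (2 * K + 4 * |κ| * M * Q) * w ^ 3 := by
  have hQ0 : 0 ≤ φ t - φ s := sub_nonneg.2 (h.angle_mono hst)
  have hρ : 0 ≤ (2 * K + 4 * |κ| * M * Q) * w ^ 3 := by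
    have : 0 ≤ Q := hQ0.trans hQ
    positivity
  have key : |U t - (U s * Real.cos (φ t - φ s) + V s * Real.sin (φ t - φ s)
        + g * w * (1 - Real.cos (φ t - φ s))
        + κ * w ^ 2 * (U s * ((φ t - φ s) * Real.sin (φ t - φ s))
          + V s * (Real.sin (φ t - φ s) - (φ t - φ s) * Real.cos (φ t - φ s))))|
      ≤ 2 * ((2 * K + 4 * |κ| * M * Q) * w ^ 3) * (φ t - φ s) := by
    refine oscillator_bound hst (φ := φ)
      (R := fun σ => w * H (w * U σ) / 2 - g * w
        - 2 * κ * w ^ 2 * (U s * Real.cos (φ σ - φ s) + V s * Real.sin (φ σ - φ s)))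
      (W := fun σ => V σ - (-(U s * Real.sin (φ σ - φ s)) + V s * Real.cos (φ σ - φ s)
        + g * w * Real.sin (φ σ - φ s)
        + κ * w ^ 2 * (U s * (Real.sin (φ σ - φ s) + (φ σ - φ s) * Real.cos (φ σ - φ s))
          + V s * ((φ σ - φ s) * Real.sin (φ σ - φ s)))))
      (D := fun σ => U σ - (U s * Real.cos (φ σ - φ s) + V s * Real.sin (φ σ - φ s)
        + g * w * (1 - Real.cos (φ σ - φ s))
        + κ * w ^ 2 * (U s * ((φ σ - φ s) * Real.sin (φ σ - φ s))
          + V s * (Real.sin (φ σ - φ s) - (φ σ - φ s) * Real.cos (φ σ - φ s)))))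
      h.rate h.angle (fun σ hσ => ?_) (fun σ hσ => ?_) (fun σ hσ => ?_) (by simp) (by simp)
    · have hψ := (h.angle σ hσ).sub_const (φ s)
      have hs := hψ.sin
      have hc := hψ.cos
      exact ((h.deriv_U σ hσ).sub ((((hc.const_mul (U s)).add (hs.const_mul (V s))).add
        ((hc.const_sub 1).const_mul (g * w))).add
        ((((hψ.mul hs).const_mul (U s)).add ((hs.sub (hψ.mul hc)).const_mul (V s))).const_mul
          (κ * w ^ 2)))).congr_deriv (by ring)
    · have hψ := (h.angle σ hσ).sub_const (φ s)
      have hs := hψ.sin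
      have hc := hψ.cos
      exact ((h.deriv_V σ hσ).sub ((((hs.const_mul (U s)).neg.add (hc.const_mul (V s))).add
        (hs.const_mul (g * w))).add
        ((((hs.add (hψ.mul hc)).const_mul (U s)).add ((hψ.mul hs).const_mul (V s))).const_mul
          (κ * w ^ 2)))).congr_deriv (by ring)
    · have hsub : Icc s σ ⊆ Icc s t := Icc_subset_Icc_right hσ.2
      have hsub' : Icc σ t ⊆ Icc s t := Icc_subset_Icc_left hσ.1
      have h1 := (h.mono hsub).first_order hσ.1 hw fun x hx => hM x (hsub hx)
      have hm := (h.mono hsub').angle_mono hσ.2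
      have e : w * H (w * U σ) / 2 - g * w
          - 2 * κ * w ^ 2 * (U s * Real.cos (φ σ - φ s) + V s * Real.sin (φ σ - φ s))
          = w / 2 * (H (w * U σ) - 2 * g - 4 * κ * (w * U σ))
            + 2 * κ * w ^ 2 *
              (U σ - (U s * Real.cos (φ σ - φ s) + V s * Real.sin (φ σ - φ s))) := by ring
      rw [e]
      refine (abs_add_le _ _).trans ?_
      rw [abs_mul, abs_mul (2 * κ * w ^ 2), abs_mul (2 * κ), abs_mul 2 κ, abs_two,
        abs_of_nonneg (by positivity : 0 ≤ w / 2), abs_of_nonneg (by positivity : 0 ≤ w ^ 2)]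
      have hU2 : U σ ^ 2 ≤ 2 ^ 2 := pow_le_pow_left₀ (h.pos σ hσ).le (hU σ hσ) 2
      -- The Taylor remainder of `H` contributes `2 K w³` because `U ≤ 2`; the replacement of `U` by
      -- the free solution contributes `4 |κ| M Q w³`.
      have b1 : w / 2 * |H (w * U σ) - 2 * g - 4 * κ * (w * U σ)| ≤ w / 2 * (K * (w ^ 2 * 2 ^ 2)) := by
        refine mul_le_mul_of_nonneg_left ((hK σ hσ).trans ?_) (by positivity)
        rw [mul_pow]
        gcongr
      have b2 : |U σ - (U s * Real.cos (φ σ - φ s) + V s * Real.sin (φ σ - φ s))|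
          ≤ 2 * (w * M) * Q := h1.trans (by gcongr; linarith)
      have b3 := mul_le_mul_of_nonneg_left b2 (by positivity : 0 ≤ 2 * |κ| * w ^ 2)
      linarith
  refine key.trans ?_
  have := mul_le_mul_of_nonneg_left hQ hρ
  linarith

/-- The inverse distance stays bounded by twice its natural scale. -/
theorem bounded {F : ℝ → ℝ} {b w₀ : ℝ} (h : IsOrbitOn H w (Iic b) U V φ ω) (hw : 0 < w)
    (henergy : ∀ σ ≤ b, U σ ^ 2 + V σ ^ 2 = F (w * U σ)) (hF : ∀ v ∈ Icc 0 w₀, F v ≤ 4)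
    (hw₀ : 2 * w < w₀) (hb : w * U b ≤ w₀) {σ : ℝ} (hσ : σ ≤ b) : U σ ≤ 2 ∧ w * U σ ≤ w₀ := by
  have imp : ∀ τ ≤ b, w * U τ ≤ w₀ → U τ ≤ 2 := fun τ hτ hle => by
    have h1 := hF (w * U τ) ⟨(mul_pos hw (h.pos τ hτ)).le, hle⟩
    rw [← henergy τ hτ] at h1
    nlinarith [sq_nonneg (V τ), h.pos τ hτ]
  -- Continuity argument: a crossing of the level `w₀` would occur where `imp` already forces `w U ≤
  -- 2 w < w₀`.
  have hle : w * U σ ≤ w₀ := by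
    by_contra! hlt
    have hcont : ContinuousOn (fun τ => w * U τ) (Icc σ b) := fun τ hτ =>
      (((h.deriv_U τ hτ.2).const_mul w).continuousWithinAt).mono Icc_subset_Iic_self
    obtain ⟨τ, hτ, he⟩ := intermediate_value_Icc' hσ hcont ⟨hb, hlt.le⟩
    have := imp τ hτ.2 he.le
    simp only at he
    nlinarith
  exact ⟨imp σ hσ hle, hle⟩

/-- Otherwise `U` would be nonincreasing in `σ` near `-∞`, hence bounded below by a positive value
there. The energy relation fixes only `V²` at infinity; this selects the sign of `V`. -/
theorem frequently_V_pos {b : ℝ} (h : IsOrbitOn H w (Iic b) U V φ ω)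
    (hU : Tendsto U atBot (𝓝 0)) : ∃ᶠ σ in atBot, 0 < V σ := by
  intro hev
  obtain ⟨c, hc⟩ := eventually_atBot.1 (hev.and (eventually_le_atBot b))
  have hcb := (hc c le_rfl).2
  have hanti : ∀ σ ≤ c, U c ≤ U σ := fun σ hσ => by
    have hsub : Icc σ c ⊆ Iic b := fun x hx => hx.2.trans hcb
    have := abs_sub_le_sub_of_deriv_le hσ (f := fun _ => 0) (f' := fun _ => 0)
      (fun σ _ => hasDerivWithinAt_const _ _ _) (g := fun x => -U x) (g' := fun x => -(ω x * V x))
      (fun x hx => ((h.deriv_U x (hsub hx)).neg).mono hsub)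
      (fun x hx => by
        have h1 := h.rate x (hsub hx)
        have h2 := not_lt.1 (hc x hx.2).1
        rw [abs_zero]
        nlinarith)
    have h0 := (abs_nonneg _).trans this
    linarith
  have := ge_of_tendsto hU ((eventually_le_atBot c).mono hanti)
  linarith [h.pos c hcb]

end IsOrbitOn

namespace IsOrbitOn

variable {H : ℝ → ℝ} {w : ℝ} {I : Set ℝ} {U V φ ω : ℝ → ℝ}

/-- Closing relation of an orbit that comes from infinity and whose swept angle is known modulo a
full turn and a reflection: the swept angle is `π - θ`, and the final inverse distance is given
by the second order solution. -/
theorem closing {F : ℝ → ℝ} {b w₀ M g κ K θ : ℝ} (h : IsOrbitOn H w (Iic b) U V φ ω)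
    (henergy : ∀ σ ≤ b, U σ ^ 2 + V σ ^ 2 = F (w * U σ))
    (hF : ∀ v ∈ Icc 0 w₀, F v ≤ 4) (hF1 : Tendsto F (𝓝 0) (𝓝 1)) (hM0 : 0 ≤ M)
    (hM : ∀ v ∈ Icc 0 w₀, |H v| ≤ 2 * M) (hK0 : 0 ≤ K)
    (hK : ∀ v ∈ Icc 0 w₀, |H v - 2 * g - 4 * κ * v| ≤ K * v ^ 2)
    (hw : 0 < w) (hw₀ : 2 * w < w₀) (hθ : θ ∈ Ioo 0 Real.pi)
    (hsmall : 16 * Real.pi * (w * M) ≤ Real.sin (θ / 2)) (hb : w * U b ≤ w₀)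
    (hU : Tendsto U atBot (𝓝 0))
    (hcos : Tendsto (fun σ => Real.cos (φ b - φ σ)) atBot (𝓝 (-Real.cos θ))) :
    |U b - (Real.sin (Real.pi - θ) + g * w * (1 - Real.cos (Real.pi - θ))
      + κ * w ^ 2 * (Real.sin (Real.pi - θ) - (Real.pi - θ) * Real.cos (Real.pi - θ)))|
      ≤ 2 * (2 * Real.pi) * (2 * K + 4 * |κ| * M * (2 * Real.pi)) * w ^ 3 := by
  have hπ := Real.pi_pos
  obtain ⟨hθ0, hθπ⟩ := hθ
  have hsin : 0 < Real.sin (θ / 2) := Real.sin_pos_of_pos_of_lt_pi (by linarith) (by linarith)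
  have hcos2 : Real.cos θ < Real.cos (θ / 2) :=
    Real.cos_lt_cos_of_nonneg_of_le_pi (by linarith) hθπ.le (by linarith)
  have hbd : ∀ σ ≤ b, U σ ≤ 2 ∧ w * U σ ≤ w₀ := fun σ hσ =>
    h.bounded hw henergy hF hw₀ hb hσ
  have hmem : ∀ σ ≤ b, w * U σ ∈ Icc 0 w₀ := fun σ hσ =>
    ⟨(mul_pos hw (h.pos σ hσ)).le, (hbd σ hσ).2⟩
  have hIcc : ∀ σ, Icc σ b ⊆ Iic b := fun σ => Icc_subset_Iic_self
  have hφc : ContinuousOn φ (Iic b) := fun σ hσ => (h.angle σ hσ).continuousWithinAt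
  -- All limits are taken along the parameters with `V > 0`, where the energy relation gives `V →
  -- 1`.
  let l : Filter ℝ := atBot ⊓ 𝓟 {σ | 0 < V σ}
  have hne : l.NeBot := frequently_mem_iff_neBot.1 (h.frequently_V_pos hU)
  have hl : l ≤ atBot := inf_le_left
  have hVpos : ∀ᶠ σ in l, 0 < V σ := mem_inf_of_right (mem_principal_self _)
  have hlb : ∀ᶠ σ in l, σ ≤ b := (eventually_le_atBot b).filter_mono hl
  have hU' : Tendsto U l (𝓝 0) := hU.mono_left hl
  have hV' : Tendsto V l (𝓝 1) := by
    have h1 : Tendsto (fun σ => Real.sqrt (F (w * U σ) - U σ ^ 2)) l (𝓝 (Real.sqrt (1 - 0 ^ 2))) := by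
      refine (Tendsto.sub (hF1.comp ?_) (hU'.pow 2)).sqrt
      simpa using hU'.const_mul w
    rw [zero_pow two_ne_zero, sub_zero, Real.sqrt_one] at h1
    refine h1.congr' ?_
    filter_upwards [hVpos, hlb] with σ h2 h3
    rw [← henergy σ h3, add_sub_cancel_left, Real.sqrt_sq h2.le]
  -- At swept angle exactly `π + θ/2` the free solution is at most `-sin (θ/2) / 2`, and by `hsmall`
  -- the perturbation is at most `sin (θ/2) / 4`. Then `U` would be negative.
  have hturn : ∀ᶠ σ in l, φ b - φ σ ≤ Real.pi + θ / 2 := by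
    filter_upwards [hlb, hU'.eventually (gt_mem_nhds (show (0 : ℝ) < Real.sin (θ / 2) / 8 by positivity)),
      hV'.eventually (lt_mem_nhds (show (1 / 2 : ℝ) < 1 by norm_num))] with s hs hUs hVs
    by_contra! hlt
    obtain ⟨σ, hσ, he⟩ := intermediate_value_Icc hs (f := fun x => φ x - φ s)
      ((hφc.mono (hIcc s)).sub continuousOn_const) (show Real.pi + θ / 2 ∈ _ from
        ⟨by simp; positivity, hlt.le⟩)
    simp only at he
    have hsub : Icc s σ ⊆ Iic b := fun x hx => hx.2.trans hσ.2
    have h1 := (h.mono hsub).first_order hσ.1 hw.le fun x hx => hM _ (hmem x (hsub hx))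
    rw [he, show Real.pi + θ / 2 = θ / 2 + Real.pi by ring, Real.sin_add_pi, Real.cos_add_pi] at h1
    have h2 := (abs_le.1 h1).2
    have h3 := h.pos σ hσ.2
    have h4 := h.pos s hs
    have h5 : 0 ≤ Real.cos (θ / 2) :=
      Real.cos_nonneg_of_neg_pi_div_two_le_of_le (by linarith) (by linarith)
    have h6 : 0 ≤ U s * Real.cos (θ / 2) := mul_nonneg h4.le h5
    have h7 : 2 * (w * M) * (θ / 2 + Real.pi) ≤ Real.sin (θ / 2) / 4 := by
      have h8 : 0 ≤ w * M := mul_nonneg hw.le hM0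
      have h9 : 2 * (w * M) * (θ / 2 + Real.pi) ≤ 2 * (w * M) * (2 * Real.pi) :=
        mul_le_mul_of_nonneg_left (by linarith) (by positivity)
      linarith
    have h10 : V s * Real.sin (θ / 2) ≥ 1 / 2 * Real.sin (θ / 2) :=
      mul_le_mul_of_nonneg_right hVs.le hsin.le
    linarith
  have hcos' := hcos.mono_left hl
  -- The arccosine recovers the angle once it lies in `[0, π]`. Between `π` and `π + θ/2` the cosine
  -- is at most `-cos (θ/2)`, which is below the limit `-cos θ`.
  have hψ : Tendsto (fun σ => φ b - φ σ) l (𝓝 (Real.pi - θ)) := by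
    have h1 := (Real.continuous_arccos.tendsto (-Real.cos θ)).comp hcos'
    rw [Real.arccos_neg, Real.arccos_cos hθ0.le hθπ.le] at h1
    refine h1.congr' ?_
    filter_upwards [hlb, hturn, hcos'.eventually (lt_mem_nhds (neg_lt_neg hcos2))]
      with s hs ht hc
    refine Real.arccos_cos (sub_nonneg.2 ((h.mono (hIcc s)).angle_mono hs)) ?_
    by_contra! hlt
    have h2 := Real.cos_le_cos_of_nonneg_of_le_pi (x := φ b - φ s - Real.pi) (y := θ / 2)
      (by linarith) (by linarith) (by linarith)
    rw [Real.cos_sub_pi] at h2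
    linarith
  have hs' := (Real.continuous_sin.tendsto _).comp hψ
  have hc' := (Real.continuous_cos.tendsto _).comp hψ
  -- The second order estimate started at `s` is passed to the limit `s → -∞`, with `U s → 0`, `V s
  -- → 1` and turn bound `Q = 2π`.
  have hlim := (((((hU'.mul hc').add (hV'.mul hs')).add
    ((hc'.const_sub 1).const_mul (g * w))).add
    (((hU'.mul (hψ.mul hs')).add (hV'.mul (hs'.sub (hψ.mul hc')))).const_mul
      (κ * w ^ 2))).const_sub (U b)).abs
  simp only [zero_mul, one_mul, zero_add] at hlim
  refine le_of_tendsto hlim ?_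
  filter_upwards [hlb, hturn] with s hs ht
  exact (h.mono (hIcc s)).second_order hs hw.le hM0 (fun x hx => hM _ (hmem x hx.2)) hK0
    (fun x hx => hK _ (hmem x hx.2)) (fun x hx => (hbd x hx.2).1) (by linarith)

end IsOrbitOn

/-! ### Inversion of the series -/

/-- Inversion of the closing relation: the ratio `B` of impact parameter to the distance `1 = w B / μ`
as a series in `μ`. -/
theorem inversion_bound {α k C B w μ : ℝ} (hw : 0 < w) (hw1 : w ≤ 1)
    (hB : B * w = μ) (hB1 : |B - 1| ≤ 1 / 2) (hC : 0 ≤ C)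
    (h : |B - (1 + α * w + k * w ^ 2)| ≤ C * w ^ 3) :
    |B - (1 + α * μ + (k - α ^ 2) * μ ^ 2)|
      ≤ 8 * (C + |α| * (|k| + C) + (|k| + |α| ^ 2) * 3 * (|α| + |k| + C)) * μ ^ 3 := by
  obtain ⟨hB2, hB3⟩ := abs_le.1 hB1
  have hμ : 0 < μ := by rw [← hB]; exact mul_pos (by linarith) hw
  have hwμ : w ≤ 2 * μ := by rw [← hB]; nlinarith
  have hμw : μ ≤ 2 * w := by rw [← hB]; nlinarith
  set e := B - (1 + α * w + k * w ^ 2) with he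
  have hBe : B = 1 + α * w + k * w ^ 2 + e := by rw [he]; ring
  -- Since `μ = B w`, one has `w - μ = -w (B - 1)`, hence `w = μ - α μ²` to second order. This
  -- shifts the quadratic coefficient from `k` to `k - α²`.
  have hd : w - μ = -(α * w ^ 2 + k * w ^ 3 + w * e) := by
    rw [← hB, hBe]; ring
  have hd2 : |w - μ| ≤ (|α| + |k| + C) * w ^ 2 := by
    rw [hd, abs_neg]
    refine (abs_add_three _ _ _).trans ?_
    rw [abs_mul, abs_mul, abs_mul, abs_of_pos hw, abs_of_pos (pow_pos hw 2),
      abs_of_pos (pow_pos hw 3)]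
    have h3 : w ^ 3 ≤ w ^ 2 := pow_le_pow_of_le_one hw.le hw1 (by norm_num)
    have h4 : w ^ 4 ≤ w ^ 2 := pow_le_pow_of_le_one hw.le hw1 (by norm_num)
    have h5 : w * |e| ≤ w * (C * w ^ 3) := mul_le_mul_of_nonneg_left h hw.le
    have h6 := mul_le_mul_of_nonneg_left h3 (abs_nonneg k)
    have h7 := mul_le_mul_of_nonneg_left h4 hC
    nlinarith
  have key : B - (1 + α * μ + (k - α ^ 2) * μ ^ 2)
      = e + -(α * (k * w ^ 3 + w * e)) + (k - α ^ 2) * ((w - μ) * (w + μ)) := by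
    rw [hBe]
    linear_combination α * hd
  rw [key]
  refine (abs_add_three _ _ _).trans ?_
  have b1 : |-(α * (k * w ^ 3 + w * e))| ≤ |α| * ((|k| + C) * w ^ 3) := by
    rw [abs_neg, abs_mul]
    refine mul_le_mul_of_nonneg_left ((abs_add_le _ _).trans ?_) (abs_nonneg _)
    rw [abs_mul, abs_mul, abs_of_pos hw, abs_of_pos (pow_pos hw 3)]
    have h5 : w * |e| ≤ 1 * (C * w ^ 3) :=
      mul_le_mul hw1 h (abs_nonneg _) zero_le_one
    linarith
  have b2 : |(k - α ^ 2) * ((w - μ) * (w + μ))|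
      ≤ (|k| + |α| ^ 2) * ((|α| + |k| + C) * w ^ 2 * (3 * w)) := by
    rw [abs_mul, abs_mul, abs_of_pos (add_pos hw hμ)]
    have h1 : |k - α ^ 2| ≤ |k| + |α| ^ 2 := by
      refine (abs_sub _ _).trans ?_
      rw [abs_pow]
    gcongr
    linarith
  -- The factor 8 in the bound comes from `w ≤ 2 μ`, itself due to `B ≥ 1/2`.
  have hw3 : w ^ 3 ≤ (2 * μ) ^ 3 := pow_le_pow_left₀ hw.le hwμ 3
  calc _ ≤ C * w ^ 3 + |α| * ((|k| + C) * w ^ 3)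
        + (|k| + |α| ^ 2) * ((|α| + |k| + C) * w ^ 2 * (3 * w)) := by gcongr
    _ = (C + |α| * (|k| + C) + (|k| + |α| ^ 2) * 3 * (|α| + |k| + C)) * w ^ 3 := by ring
    _ ≤ (C + |α| * (|k| + C) + (|k| + |α| ^ 2) * 3 * (|α| + |k| + C)) * (2 * μ) ^ 3 := by
      gcongr
    _ = _ := by ring

/-! ### The refractive index -/

namespace PotentialExpansion

/-- The square of the effective refractive index, as a function of `m / r`. -/
noncomputable def indexSq (P : PotentialExpansion) (w : ℝ) : ℝ := powerSum P.e w / powerSum P.a w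

theorem powerSum_a_zero (P : PotentialExpansion) : powerSum P.a 0 = 1 := by
  rw [powerSum_zero, P.a_zero]

theorem powerSum_e_zero (P : PotentialExpansion) : powerSum P.e 0 = 1 := by
  rw [powerSum_zero, P.e_zero]

theorem tendsto_indexSq (P : PotentialExpansion) {R : ℝ} (hR : 0 < R)
    (ha : ∀ w ∈ Ioo 0 R, Summable fun n : ℕ => P.a n * w ^ n)
    (he : ∀ w ∈ Ioo 0 R, Summable fun n : ℕ => P.e n * w ^ n) :
    Tendsto P.indexSq (𝓝 0) (𝓝 1) := by
  have h0 : |(0 : ℝ)| < R := by simpa using hR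
  have h := (powerSum_analyticAt he h0).continuousAt.tendsto.div
    (powerSum_analyticAt ha h0).continuousAt.tendsto (by rw [P.powerSum_a_zero]; norm_num)
  rw [P.powerSum_a_zero, P.powerSum_e_zero, div_one] at h
  exact h

/-- The quotient of the two series is `1 + 2(1+γ) w + 2κ w² + ⋯`; this is the origin of `κ`. The
tails of both series are analytic at 0, so the remainder of the derivative is `w²` times a function
continuous there. -/
theorem deriv_indexSq_eventually (P : PotentialExpansion) {R : ℝ} (hR : 0 < R)
    (ha : ∀ w ∈ Ioo 0 R, Summable fun n : ℕ => P.a n * w ^ n)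
    (he : ∀ w ∈ Ioo 0 R, Summable fun n : ℕ => P.e n * w ^ n) :
    ∃ K, 0 ≤ K ∧ ∀ᶠ w in 𝓝 0,
      |deriv P.indexSq w - 2 * (1 + P.γ) - 4 * P.kappa * w| ≤ K * w ^ 2 := by
  set f := powerSum fun n => P.a (n + 3) with hf
  set h := powerSum fun n => P.e (n + 3) with hh
  have h0 : |(0 : ℝ)| < R := by simpa using hR
  have hfa : AnalyticAt ℝ f 0 :=
    powerSum_analyticAt (R := R) (fun w hw => summable_shift (ha w hw) hw.1.ne') h0
  have hha : AnalyticAt ℝ h 0 :=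
    powerSum_analyticAt (R := R) (fun w hw => summable_shift (he w hw) hw.1.ne') h0
  set D : ℝ → ℝ := fun w => 1 - 2 * w + 2 * P.β * w ^ 2 + w ^ 3 * f w with hD
  set N : ℝ → ℝ := fun w => 1 + 2 * P.γ * w + 3 / 2 * P.ε * w ^ 2 + w ^ 3 * h w with hN
  have hfc := hfa.continuousAt
  have hhc := hha.continuousAt
  have hfc' := hfa.deriv.continuousAt
  have hhc' := hha.deriv.continuousAt
  have hDc : ContinuousAt D 0 := by fun_prop
  have hNc : ContinuousAt N 0 := by fun_prop
  have hD0 : D 0 ≠ 0 := by simp [hD]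
  have hnear : ∀ᶠ w : ℝ in 𝓝 0, |w| < R := (continuous_abs.tendsto 0).eventually (gt_mem_nhds h0)
  have hEq : P.indexSq =ᶠ[𝓝 0] fun w => N w / D w := by
    filter_upwards [hnear] with w hw
    simp only [indexSq, powerSum_expand ha hw, powerSum_expand he hw, P.a_zero, P.a_one, P.a_two,
      P.e_zero, P.e_one, P.e_two, hD, hN, hf, hh]
    congr 1
    ring
  -- Up to `D²`, this is `N' D - N D' - (2(1+γ) + 4κ w) D²` divided by `w²`; the terms of degree 0
  -- and 1 cancel by the value of `κ`.
  set q : ℝ → ℝ := fun w =>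
    (-6 * P.ε + (2 * P.β + w * f w) * (2 * P.γ + 3 * P.ε * w) + (3 * h w + w * deriv h w) * D w
      - 8 * P.γ * P.β - (3 / 2 * P.ε + w * h w) * (-2 + 4 * P.β * w)
      - (3 * f w + w * deriv f w) * N w + 16 * P.kappa
      - (2 * (1 + P.γ) + 4 * P.kappa * w) * (4 + 2 * (2 * P.β + w * f w) * (1 - 2 * w)
        + w ^ 2 * (2 * P.β + w * f w) ^ 2)) / D w ^ 2 with hq
  have hqc : ContinuousAt q 0 := by
    refine ContinuousAt.div (by fun_prop) (by fun_prop) (pow_ne_zero 2 hD0)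
  refine ⟨|q 0| + 1, by positivity, ?_⟩
  filter_upwards [hEq.eventuallyEq_nhds, hfa.eventually_analyticAt, hha.eventually_analyticAt,
    hDc.eventually_ne hD0, hqc.abs.eventually (gt_mem_nhds (lt_add_one |q 0|))]
    with w h1 h2 h3 h4 h5
  have hf' := h2.differentiableAt.hasDerivAt
  have hh' := h3.differentiableAt.hasDerivAt
  have hDd : HasDerivAt D (-2 + 4 * P.β * w + w ^ 2 * (3 * f w + w * deriv f w)) w := by
    refine ((((hasDerivAt_id w).const_mul 2).const_sub 1).add
      ((hasDerivAt_pow 2 w).const_mul (2 * P.β)) |>.add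
      ((hasDerivAt_pow 3 w).mul hf')).congr_deriv ?_
    push_cast
    ring
  have hNd : HasDerivAt N (2 * P.γ + 3 * P.ε * w + w ^ 2 * (3 * h w + w * deriv h w)) w := by
    refine ((((hasDerivAt_id w).const_mul (2 * P.γ)).const_add 1).add
      ((hasDerivAt_pow 2 w).const_mul (3 / 2 * P.ε)) |>.add
      ((hasDerivAt_pow 3 w).mul hh')).congr_deriv ?_
    push_cast
    ring
  have hd : deriv P.indexSq w - 2 * (1 + P.γ) - 4 * P.kappa * w = w ^ 2 * q w := by
    rw [h1.deriv_eq, (hNd.fun_div hDd h4).deriv, hq]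
    field_simp
    simp only [hD, hN, kappa]
    ring
  rw [hd, abs_mul, abs_of_nonneg (sq_nonneg w), mul_comm]
  exact mul_le_mul_of_nonneg_right h5.le (sq_nonneg w)

/-- All the orbit estimates use these constants, which are fixed before any ray or any `r_h` is
given. The value 4 bounds `U²` and so yields `U ≤ 2`. -/
theorem indexSq_bounds (P : PotentialExpansion) {R : ℝ} (hR : 0 < R)
    (ha : ∀ w ∈ Ioo 0 R, Summable fun n : ℕ => P.a n * w ^ n)
    (he : ∀ w ∈ Ioo 0 R, Summable fun n : ℕ => P.e n * w ^ n) :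
    ∃ w₀ M K : ℝ, 0 < w₀ ∧ 0 ≤ M ∧ 0 ≤ K ∧ (∀ v ∈ Icc 0 w₀, P.indexSq v ≤ 4) ∧
      (∀ v ∈ Icc 0 w₀, |deriv P.indexSq v| ≤ 2 * M) ∧
      ∀ v ∈ Icc 0 w₀,
        |deriv P.indexSq v - 2 * (1 + P.γ) - 4 * P.kappa * v| ≤ K * v ^ 2 := by
  obtain ⟨K, hK, hev⟩ := P.deriv_indexSq_eventually hR ha he
  have h1 := (P.tendsto_indexSq hR ha he).eventually (gt_mem_nhds (show (1 : ℝ) < 4 by norm_num))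
  obtain ⟨r, hr, hball⟩ := Metric.eventually_nhds_iff.1 (hev.and h1)
  refine ⟨min (r / 2) 1, |1 + P.γ| + 2 * |P.kappa| + K, K, by positivity, by positivity, hK,
    ?_, ?_, ?_⟩
  all_goals
    intro v hv
    have hv1 : v ≤ 1 := hv.2.trans (min_le_right _ _)
    have hv2 : v ≤ r / 2 := hv.2.trans (min_le_left _ _)
    have hb := @hball v (by rw [Real.dist_0_eq_abs, abs_of_nonneg hv.1]; linarith)
  · exact hb.2.le
  · have e : deriv P.indexSq v = (deriv P.indexSq v - 2 * (1 + P.γ) - 4 * P.kappa * v)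
        + 2 * (1 + P.γ) + 4 * P.kappa * v := by ring
    rw [e]
    refine (abs_add_three _ _ _).trans ?_
    rw [abs_mul 2, abs_mul (4 * P.kappa), abs_mul 4, abs_two, abs_of_nonneg hv.1,
      abs_of_pos (show (0 : ℝ) < 4 by norm_num)]
    have h2 : K * v ^ 2 ≤ K * 1 := mul_le_mul_of_nonneg_left (pow_le_one₀ hv.1 hv1) hK
    have h3 : 4 * |P.kappa| * v ≤ 4 * |P.kappa| * 1 :=
      mul_le_mul_of_nonneg_left hv1 (by positivity)
    linarith [hb.1]
  · exact hb.1

end PotentialExpansion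

/-! ### Polar form of a central motion -/

section CentralMotion

variable {x p : ℝ → E3} {lam k : ℝ → ℝ} {B : ℝ}

theorem hasDerivWithinAt_norm_of_ne_zero {I : Set ℝ} {σ : ℝ} {v : E3} (hx : HasDerivWithinAt x v I σ)
    (h0 : x σ ≠ 0) : HasDerivWithinAt (fun s => ‖x s‖) (inner ℝ (x σ) v / ‖x σ‖) I σ := by
  have h1 := hx.norm_sq.sqrt (by positivity)
  simp only [Real.sqrt_sq (norm_nonneg _)] at h1
  exact h1.congr_deriv (by have := norm_ne_zero_iff.2 h0; field_simp)

/-- Polar description of a motion in a central field. -/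
theorem exists_orbit {m b : ℝ} {H : ℝ → ℝ}
    (hx : ∀ σ ∈ Iic B, HasDerivWithinAt x (lam σ • p σ) (Iic B) σ)
    (hp : ∀ σ ∈ Iic B, HasDerivWithinAt p (k σ • x σ) (Iic B) σ)
    (hx0 : ∀ σ ∈ Iic B, x σ ≠ 0) (hlam : ∀ σ ∈ Iic B, 0 < lam σ)
    (hlamc : ContinuousOn lam (Iic B))
    (hk : ∀ σ ∈ Iic B, k σ = -(lam σ / 2 * m * H (m / ‖x σ‖) / ‖x σ‖ ^ 3))
    (hb : 0 < b)
    (hb2 : ∀ σ ∈ Iic B, b ^ 2 = ‖x σ‖ ^ 2 * ‖p σ‖ ^ 2 - inner ℝ (x σ) (p σ) ^ 2) :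
    ∃ U V φ ω : ℝ → ℝ, IsOrbitOn H (m / b) (Iic B) U V φ ω ∧
      (∀ σ, U σ = b / ‖x σ‖) ∧ (∀ σ ∈ Iic B, U σ ^ 2 + V σ ^ 2 = ‖p σ‖ ^ 2) ∧
      ∀ σ ∈ Iic B, Real.cos (φ B - φ σ) = inner ℝ (unitDir (x σ)) (unitDir (x B)) := by
  have hr : ∀ σ ∈ Iic B, 0 < ‖x σ‖ := fun σ hσ => norm_pos_iff.2 (hx0 σ hσ)
  have hrd : ∀ σ ∈ Iic B, HasDerivWithinAt (fun s => ‖x s‖)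
      (lam σ * inner ℝ (x σ) (p σ) / ‖x σ‖) (Iic B) σ := fun σ hσ =>
    (hasDerivWithinAt_norm_of_ne_zero (hx σ hσ) (hx0 σ hσ)).congr_deriv (by
      rw [inner_smul_right])
  have hid : ∀ σ ∈ Iic B, HasDerivWithinAt (fun s => inner ℝ (x s) (p s))
      (k σ * ‖x σ‖ ^ 2 + lam σ * ‖p σ‖ ^ 2) (Iic B) σ := fun σ hσ =>
    ((hx σ hσ).inner ℝ (hp σ hσ)).congr_deriv (by
      rw [inner_smul_right, inner_smul_left, real_inner_self_eq_norm_sq,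
        real_inner_self_eq_norm_sq]; simp)
  set ω : ℝ → ℝ := fun σ => lam σ * b / ‖x σ‖ ^ 2 with hω
  have hωc : ContinuousOn ω (Iic B) := by
    have : ContinuousOn (fun s => ‖x s‖) (Iic B) := fun σ hσ => (hrd σ hσ).continuousWithinAt
    exact (hlamc.mul continuousOn_const).div (this.pow 2) fun σ hσ => (pow_pos (hr σ hσ) 2).ne'
  -- Freezing `ω` beyond `B` makes it continuous on the whole line, so its integral from `B` is
  -- differentiable up to the endpoint.
  have hωc' : Continuous fun σ => ω (min σ B) :=
    continuousOn_univ.1 (hωc.comp (by fun_prop) fun σ _ => min_le_right σ B)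
  set φ : ℝ → ℝ := fun σ => ∫ s in B..σ, ω (min s B) with hφ
  have hφd : ∀ σ ∈ Iic B, HasDerivWithinAt φ (ω σ) (Iic B) σ := fun σ hσ => by
    have := (hωc'.integral_hasStrictDerivAt B σ).hasDerivAt.hasDerivWithinAt (s := Iic B)
    rwa [min_eq_left hσ] at this
  -- The radial direction `n` and the transverse direction `τ` in the plane of motion form a
  -- rotating frame, `n' = ω τ` and `τ' = -ω n`. Undoing the rotation by `φ`, as in `hconst`, gives
  -- a constant vector, so `φ` is the polar angle.
  set n : ℝ → E3 := fun σ => (‖x σ‖)⁻¹ • x σ with hn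
  set τ : ℝ → E3 := fun σ => (‖x σ‖ / b) • p σ - (inner ℝ (x σ) (p σ) / (b * ‖x σ‖)) • x σ with hτ
  have hnd : ∀ σ ∈ Iic B, HasDerivWithinAt n (ω σ • τ σ) (Iic B) σ := fun σ hσ => by
    have h1 := hr σ hσ
    refine (((hrd σ hσ).inv h1.ne').smul (hx σ hσ)).congr_deriv ?_
    simp only [hω, hτ]
    match_scalars
    · simp only [Pi.inv_apply]
      field_simp
    · field_simp
  have hτd : ∀ σ ∈ Iic B, HasDerivWithinAt τ (-(ω σ) • n σ) (Iic B) σ := fun σ hσ => by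
    have h1 := hr σ hσ
    refine ((((hrd σ hσ).div_const b).smul (hp σ hσ)).sub
      (((hid σ hσ).div ((hrd σ hσ).const_mul b) (by positivity)).smul (hx σ hσ))).congr_deriv ?_
    simp only [hω, hn]
    match_scalars
    · field_simp
      have := hb2 σ hσ
      linear_combination (lam σ) * this
    · simp only [Pi.div_apply]
      field_simp
      ring
  have hconst : ∀ σ ∈ Iic B, Real.cos (φ σ) • n σ - Real.sin (φ σ) • τ σ = n B := fun σ hσ => by
    rw [eq_of_hasDerivWithinAt_zero (f := fun σ => Real.cos (φ σ) • n σ - Real.sin (φ σ) • τ σ)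
      (fun s hs => ?_) hσ]
    · simp [hφ]
    · refine (((hφd s hs).cos.smul (hnd s hs)).sub
        ((hφd s hs).sin.smul (hτd s hs))).congr_deriv ?_
      match_scalars <;> ring
  -- `V` is minus the radial component of `p`, so that the energy relation is the decomposition of
  -- `|p|²` into transverse and radial parts.
  refine ⟨fun σ => b / ‖x σ‖, fun σ => -(inner ℝ (x σ) (p σ) / ‖x σ‖), φ, ω,
    ⟨fun σ hσ => div_pos hb (hr σ hσ), fun σ hσ => ?_, hφd, fun σ hσ => ?_, fun σ hσ => ?_⟩,
    fun σ => rfl, fun σ hσ => ?_, fun σ hσ => ?_⟩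
  · have := hlam σ hσ
    positivity
  · have h1 := hr σ hσ
    refine ((hasDerivWithinAt_const σ (Iic B) b).div (hrd σ hσ) h1.ne').congr_deriv ?_
    simp only [hω]
    field_simp
    ring
  · have h1 := hr σ hσ
    refine ((hid σ hσ).div (hrd σ hσ) h1.ne').neg.congr_deriv ?_
    simp only [hω, hk σ hσ]
    rw [show m / b * (b / ‖x σ‖) = m / ‖x σ‖ by field_simp]
    field_simp
    have := hb2 σ hσ
    linear_combination (2 * lam σ) * this
  · have h1 := hr σ hσ
    simp only
    rw [neg_sq, div_pow, div_pow, ← add_div, hb2 σ hσ]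
    field_simp
    ring
  · have h1 := hr σ hσ
    have hnn : inner ℝ (n σ) (n σ) = 1 := by
      rw [real_inner_self_eq_norm_sq, hn, norm_smul, norm_inv, norm_norm, inv_mul_cancel₀ h1.ne']
      norm_num
    have hnτ : inner ℝ (n σ) (τ σ) = 0 := by
      simp only [hn, hτ, inner_sub_right, inner_smul_left, inner_smul_right,
        real_inner_self_eq_norm_sq, conj_trivial]
      field_simp
      ring
    have h2 : unitDir (x σ) = n σ := rfl
    have h3 : unitDir (x B) = n B := rfl
    rw [h2, h3, ← hconst σ hσ, inner_sub_right, real_inner_smul_right (n σ) (n σ),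
      real_inner_smul_right (n σ) (τ σ), hnn, hnτ]
    simp [hφ]

end CentralMotion

/-! ### Asymptotics at infinity and the limit of the finite-distance expression -/

section Asymptotics

theorem norm_unitDir {x : E3} (hx : x ≠ 0) : ‖unitDir x‖ = 1 := by
  rw [unitDir, norm_smul, norm_inv, norm_norm, inv_mul_cancel₀ (norm_ne_zero_iff.2 hx)]

theorem unitDir_smul {c : ℝ} (hc : 0 < c) (x : E3) : unitDir (c • x) = unitDir x := by
  rw [unitDir, unitDir, norm_smul, Real.norm_of_nonneg hc.le, smul_smul, mul_inv]
  congr 1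
  field_simp

theorem continuousAt_unitDir {x : E3} (hx : x ≠ 0) : ContinuousAt unitDir x :=
  (continuousAt_id.norm.inv₀ (norm_ne_zero_iff.2 hx)).smul continuousAt_id

theorem unitDir_of_norm_eq_one {x : E3} (hx : ‖x‖ = 1) : unitDir x = x := by
  rw [unitDir, hx, inv_one, one_smul]

variable {x : ℝ → E3} {Ne : E3}

/-- The part of `x` transverse to `Ne` converges, so it disappears on division by the longitudinal
distance. -/
theorem tendsto_inv_smul_of_asymptote (h1 : Tendsto (fun σ => inner ℝ (x σ) Ne) atBot atBot)
    (h2 : ∃ p : E3, Tendsto (fun σ => x σ - inner ℝ (x σ) Ne • Ne) atBot (𝓝 p)) :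
    Tendsto (fun σ => (-inner ℝ (x σ) Ne)⁻¹ • x σ) atBot (𝓝 (-Ne)) := by
  obtain ⟨p, hp⟩ := h2
  have h3 : Tendsto (fun σ => (-inner ℝ (x σ) Ne)⁻¹) atBot (𝓝 0) :=
    tendsto_inv_atTop_zero.comp (tendsto_neg_atBot_atTop.comp h1)
  have h4 := (h3.smul hp).add_const (-Ne)
  rw [zero_smul, zero_add] at h4
  refine h4.congr' ?_
  filter_upwards [h1.eventually (eventually_lt_atBot 0)] with σ hσ
  have hne := hσ.ne
  match_scalars
  · ring
  · field_simp
    ring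

theorem tendsto_norm_of_asymptote (hNe : ‖Ne‖ = 1)
    (h1 : Tendsto (fun σ => inner ℝ (x σ) Ne) atBot atBot) :
    Tendsto (fun σ => ‖x σ‖) atBot atTop := by
  refine tendsto_atTop_mono (fun σ => ?_) (tendsto_neg_atBot_atTop.comp h1)
  have := abs_real_inner_le_norm (x σ) Ne
  rw [hNe, mul_one] at this
  exact (neg_le_abs _).trans this

theorem tendsto_unitDir_of_asymptote (hNe : ‖Ne‖ = 1)
    (h1 : Tendsto (fun σ => inner ℝ (x σ) Ne) atBot atBot)
    (h2 : ∃ p : E3, Tendsto (fun σ => x σ - inner ℝ (x σ) Ne • Ne) atBot (𝓝 p)) :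
    Tendsto (fun σ => unitDir (x σ)) atBot (𝓝 (-Ne)) := by
  have h0 : -Ne ≠ 0 := neg_ne_zero.2 (norm_ne_zero_iff.1 (by rw [hNe]; norm_num))
  have h3 := (continuousAt_unitDir h0).tendsto.comp (tendsto_inv_smul_of_asymptote h1 h2)
  rw [unitDir_of_norm_eq_one (by rwa [norm_neg])] at h3
  refine h3.congr' ?_
  filter_upwards [h1.eventually (eventually_lt_atBot 0)] with σ hσ
  exact unitDir_smul (inv_pos.2 (neg_pos.2 hσ)) _

theorem inner_bounds_of_cross_ne_zero {u v : E3} (hu : ‖u‖ = 1) (hv : ‖v‖ = 1)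
    (h : cross u v ≠ 0) : inner ℝ u v ∈ Ioo (-1 : ℝ) 1 := by
  have h1 := norm_cross_sq u v
  have h2 : 0 < ‖cross u v‖ ^ 2 := by positivity
  rw [hu, hv] at h1
  have : inner ℝ u v ^ 2 < 1 := by linarith
  exact abs_lt.1 ((sq_lt_one_iff_abs_lt_one _).1 this)

/-- Every ingredient converges: `n_A → -Ne`, `N → Ne`, `r_A / |x_B - x_A| → 1`. Thus `N × n_A → 0`,
and `arccos (-c) = π - arccos c` produces the final form. The hypothesis on the cross product keeps
the limiting denominators nonzero. -/
theorem tendsto_impactFinite (P : PotentialExpansion) (m : ℝ) {xB : E3} (hNe : ‖Ne‖ = 1)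
    (hxB : cross Ne (unitDir xB) ≠ 0)
    (h1 : Tendsto (fun σ => inner ℝ (x σ) Ne) atBot atBot)
    (h2 : ∃ p : E3, Tendsto (fun σ => x σ - inner ℝ (x σ) Ne • Ne) atBot (𝓝 p)) :
    Tendsto (fun σ => P.impactFinite m (x σ) xB) atBot (𝓝 (P.impactInfinity m Ne xB)) := by
  have hxB0 : xB ≠ 0 := by
    rintro rfl
    apply hxB
    ext i; simp [cross, unitDir]
  have hNe0 : Ne ≠ 0 := norm_ne_zero_iff.1 (by rw [hNe]; norm_num)
  have hc := inner_bounds_of_cross_ne_zero hNe (norm_unitDir hxB0) hxB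
  have hs := norm_ne_zero_iff.2 hxB
  have hA := tendsto_unitDir_of_asymptote hNe h1 h2
  have hy := tendsto_inv_smul_of_asymptote h1 h2
  have hi : Tendsto (fun σ => (-inner ℝ (x σ) Ne)⁻¹) atBot (𝓝 0) :=
    tendsto_inv_atTop_zero.comp (tendsto_neg_atBot_atTop.comp h1)
  have hz := (hi.smul_const xB).sub hy
  rw [zero_smul, sub_neg_eq_add, zero_add] at hz
  have hN : Tendsto (fun σ => unitDir (xB - x σ)) atBot (𝓝 Ne) := by
    have h3 := (continuousAt_unitDir hNe0).tendsto.comp hz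
    rw [unitDir_of_norm_eq_one hNe] at h3
    refine h3.congr' ?_
    filter_upwards [h1.eventually (eventually_lt_atBot 0)] with σ hσ
    simp only [Function.comp]
    rw [← smul_sub]
    exact unitDir_smul (inv_pos.2 (neg_pos.2 hσ)) _
  have hratio : Tendsto (fun σ => ‖x σ‖ / ‖xB - x σ‖) atBot (𝓝 1) := by
    have h3 := hy.norm.div hz.norm (by rw [hNe]; norm_num)
    rw [norm_neg, hNe, div_one] at h3
    refine h3.congr' ?_
    filter_upwards [h1.eventually (eventually_lt_atBot 0)] with σ hσ
    simp only [Pi.div_apply]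
    rw [← smul_sub, norm_smul, norm_smul, mul_div_mul_left]
    exact norm_ne_zero_iff.2 (inv_ne_zero (neg_ne_zero.2 hσ.ne))
  set nB := unitDir xB with hnB
  have hcross : ∀ {u v : ℝ → E3} {a b : E3}, Tendsto u atBot (𝓝 a) → Tendsto v atBot (𝓝 b) →
      Tendsto (fun σ => ‖cross (u σ) (v σ)‖) atBot (𝓝 ‖cross a b‖) := fun hu hv =>
    ((continuous_cross.tendsto _).comp (hu.prodMk_nhds hv)).norm
  have cAB := hcross hA (tendsto_const_nhds (x := nB))
  have cNA := hcross hN hA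
  have cNB := hcross hN (tendsto_const_nhds (x := nB))
  have iAB := hA.inner (𝕜 := ℝ) (tendsto_const_nhds (x := nB))
  have iNA := hN.inner (𝕜 := ℝ) hA
  have iNB := hN.inner (𝕜 := ℝ) (tendsto_const_nhds (x := nB))
  rw [← neg_one_smul ℝ Ne] at cAB cNA iAB iNA
  rw [cross_smul_left, neg_one_smul, norm_neg] at cAB
  rw [cross_smul_right, cross_self_eq_zero, smul_zero, norm_zero] at cNA
  rw [real_inner_smul_left, neg_one_mul] at iAB
  rw [real_inner_smul_right, real_inner_self_eq_norm_sq, hNe, one_pow, mul_one] at iNA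
  have hrc0 : PotentialExpansion.rcInfinity Ne xB ≠ 0 :=
    mul_ne_zero (norm_ne_zero_iff.2 hxB0) hs
  have hrc : Tendsto (fun σ => ‖x σ‖ * ‖xB‖ * ‖cross (unitDir (x σ)) nB‖ / ‖xB - x σ‖) atBot
      (𝓝 (PotentialExpansion.rcInfinity Ne xB)) := by
    have := hratio.mul (cAB.const_mul ‖xB‖)
    rw [one_mul] at this
    exact this.congr fun σ => by ring
  have hd : 1 + -inner ℝ Ne nB ≠ 0 := by linarith [hc.2]
  have harc := (Real.continuous_arccos.tendsto _).comp iAB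
  have hlim := hrc.mul (((tendsto_const_nhds (x := (1 : ℝ))).add
    (((tendsto_const_nhds (x := (1 + P.γ) * m)).div hrc hrc0).mul
      ((cNA.add cNB).div (iAB.const_add 1) hd))).add
    (((tendsto_const_nhds (x := m ^ 2)).div (hrc.pow 2) (pow_ne_zero 2 hrc0)).mul
      ((((harc.div cAB hs).mul (iNA.mul iNB)).const_sub 1 |>.const_mul P.kappa).sub
        ((((iNA.mul iNB).const_sub 1).div (iAB.const_add 1) hd).const_mul ((1 + P.γ) ^ 2)))))
  convert hlim using 2
  · rfl
  · simp only [PotentialExpansion.impactInfinity, Real.arccos_neg, zero_add, hnB]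
    ring

end Asymptotics

/-! ### From null geodesics to a central motion -/

namespace PotentialExpansion

variable {P : PotentialExpansion} {m rh : ℝ}

theorem RegularOutside.summable (h : P.RegularOutside m rh) (hrh : 0 < rh) {w : ℝ}
    (hw : w ∈ Ioo 0 (m / rh)) :
    (Summable fun n : ℕ => P.a n * w ^ n) ∧ (Summable fun n : ℕ => P.e n * w ^ n) ∧
      0 < powerSum P.a w ∧ 0 < powerSum P.e w := by
  have hm : 0 < m := by
    have := hw.1.trans hw.2
    rwa [div_pos_iff_of_pos_right hrh] at this
  have h1 := h (m / w) (by
    rw [lt_div_iff₀ hw.1, mul_comm]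
    exact (lt_div_iff₀ hrh).1 hw.2)
  have h2 : m / (m / w) = w := by
    have := hw.1.ne'
    field_simp
  rw [h2] at h1
  refine ⟨h1.1, h1.2.1, ?_, ?_⟩
  · have := h1.2.2.1; rwa [potA, h2] at this
  · have := h1.2.2.2; rwa [invB, h2] at this

theorem hasDerivAt_powerSum_div {c : ℕ → ℝ} {R r : ℝ}
    (h : ∀ w ∈ Ioo 0 R, Summable fun n : ℕ => c n * w ^ n) (hr : 0 < r) (hw : |m / r| < R) :
    HasDerivAt (fun s => powerSum c (m / s)) (deriv (powerSum c) (m / r) * (-m / r ^ 2)) r := by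
  have h1 := (powerSum_analyticAt h hw).differentiableAt.hasDerivAt
  have h2 := ((hasDerivAt_const r m).div (hasDerivAt_id r) hr.ne')
  exact (h1.comp r (h := fun s => m / s) h2).congr_deriv (by simp)

/-- Reduced form of the geodesic equations in terms of the rescaled spatial momentum `p`. -/
structure IsReducedRay (P : PotentialExpansion) (m B E : ℝ) (x p : ℝ → E3) : Prop where
  energy_ne_zero : E ≠ 0
  deriv_x : ∀ σ ∈ Iic B,
    HasDerivWithinAt x ((|E| / P.invB m ‖x σ‖) • p σ) (Iic B) σ
  deriv_p : ∀ σ ∈ Iic B, HasDerivWithinAt p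
    (-(|E| / P.invB m ‖x σ‖ / 2 * m * deriv P.indexSq (m / ‖x σ‖) / ‖x σ‖ ^ 3) • x σ) (Iic B) σ
  norm_sq : ∀ σ ∈ Iic B, ‖p σ‖ ^ 2 = P.indexSq (m / ‖x σ‖)

/-- `E` is the conserved `l₀`; it cannot vanish, since the null condition would then kill the whole
tangent vector. Eliminating `dt/dσ` by the null condition combines the derivatives of both
potentials into that of `indexSq`. Dividing by `|E|` rather than `E` keeps the rate positive for
either time orientation and alters the angular momentum by a sign only. -/
theorem IsNullGeodesicOn.isReducedRay {B : ℝ} {t : ℝ → ℝ} {x : ℝ → E3}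
    (h : P.IsNullGeodesicOn m (Iic B) t x) (hm : 0 < m) (hrh : 0 < rh)
    (hreg : P.RegularOutside m rh) (hx : ∀ σ ∈ Iic B, rh < ‖x σ‖) :
    ∃ E : ℝ, (∀ σ ∈ Iic B, P.potA m ‖x σ‖ * derivWithin t (Iic B) σ = E) ∧
      P.IsReducedRay m B E x
        fun σ => |E|⁻¹ • (P.invB m ‖x σ‖ • derivWithin x (Iic B) σ) := by
  set E := P.potA m ‖x B‖ * derivWithin t (Iic B) B with hE
  have hEσ : ∀ σ ∈ Iic B, P.potA m ‖x σ‖ * derivWithin t (Iic B) σ = E := fun σ hσ =>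
    eq_of_hasDerivWithinAt_zero h.eq_time hσ
  have hA : ∀ σ ∈ Iic B, 0 < P.potA m ‖x σ‖ := fun σ hσ => (hreg _ (hx σ hσ)).2.2.1
  have hS : ∀ σ ∈ Iic B, 0 < P.invB m ‖x σ‖ := fun σ hσ => (hreg _ (hx σ hσ)).2.2.2
  have ht : ∀ σ ∈ Iic B, derivWithin t (Iic B) σ = E / P.potA m ‖x σ‖ := fun σ hσ => by
    rw [← hEσ σ hσ, mul_div_cancel_left₀ _ (hA σ hσ).ne']
  have hv : ∀ σ ∈ Iic B, ‖derivWithin x (Iic B) σ‖ ^ 2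
      = E ^ 2 / (P.potA m ‖x σ‖ * P.invB m ‖x σ‖) := fun σ hσ => by
    have h1 := h.null σ hσ
    rw [ht σ hσ] at h1
    have h2 := (hA σ hσ).ne'
    have h3 := (hS σ hσ).ne'
    field_simp at h1 ⊢
    linarith
  have hE0 : E ≠ 0 := fun h0 => by
    have h1 := ht B self_mem_Iic
    have h2 := hv B self_mem_Iic
    rw [h0] at h1 h2
    rcases h.tangent_ne_zero B self_mem_Iic with h3 | h3
    · simp at h1; exact h3 h1
    · simp at h2; exact h3 h2
  refine ⟨E, hEσ, hE0, fun σ hσ => ?_, fun σ hσ => ?_, fun σ hσ => ?_⟩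
  · have h1 := (h.differentiable_pos σ hσ).hasDerivWithinAt
    have h2 := (hS σ hσ).ne'
    have h3 := abs_ne_zero.2 hE0
    refine h1.congr_deriv ?_
    rw [smul_smul, smul_smul]
    rw [show |E| / P.invB m ‖x σ‖ * |E|⁻¹ * P.invB m ‖x σ‖ = 1 by field_simp, one_smul]
  · have h1 := ((h.eq_space σ hσ).neg).const_smul |E|⁻¹
    have hr : 0 < ‖x σ‖ := hrh.trans (hx σ hσ)
    have hw : |m / ‖x σ‖| < m / rh := by
      rw [abs_of_pos (by positivity)]
      exact div_lt_div_of_pos_left hm hrh (hx σ hσ)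
    have dA := hasDerivAt_powerSum_div (fun w hw => (hreg.summable hrh hw).1) hr hw
    have dS := hasDerivAt_powerSum_div (fun w hw => (hreg.summable hrh hw).2.1) hr hw
    have hA' := hA σ hσ
    have hS' := hS σ hσ
    have eA : P.potA m ‖x σ‖ = powerSum P.a (m / ‖x σ‖) := rfl
    have eS : P.invB m ‖x σ‖ = powerSum P.e (m / ‖x σ‖) := rfl
    have dI : deriv P.indexSq (m / ‖x σ‖) = (deriv (powerSum P.e) (m / ‖x σ‖) * P.potA m ‖x σ‖
        - P.invB m ‖x σ‖ * deriv (powerSum P.a) (m / ‖x σ‖)) / P.potA m ‖x σ‖ ^ 2 := by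
      have d1 := (powerSum_analyticAt (fun w hw => (hreg.summable hrh hw).1) hw
        ).differentiableAt.hasDerivAt
      have d2 := (powerSum_analyticAt (fun w hw => (hreg.summable hrh hw).2.1) hw
        ).differentiableAt.hasDerivAt
      exact (d2.fun_div d1 hA'.ne').deriv
    refine (h1.congr_deriv ?_).congr (fun s _ => ?_) ?_
    · rw [show deriv (P.potA m) ‖x σ‖ = _ from dA.deriv,
        show deriv (P.invB m) ‖x σ‖ = _ from dS.deriv, ht σ hσ, hv σ hσ, dI, ← neg_smul, smul_smul]
      congr 1
      have h3 := abs_ne_zero.2 hE0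
      field_simp
      rw [sq_abs]
      ring
    · simp
    · simp
  · have h2 := (hA σ hσ).ne'
    have h3 := (hS σ hσ).ne'
    have h4 := abs_ne_zero.2 hE0
    rw [norm_smul, norm_smul, mul_pow, mul_pow, hv σ hσ, Real.norm_eq_abs, Real.norm_eq_abs,
      abs_inv, abs_abs, inv_pow, sq_abs, sq_abs]
    change _ = P.invB m ‖x σ‖ / P.potA m ‖x σ‖
    field_simp

end PotentialExpansion

/-! ### Angular momentum and the closing estimate for a ray -/

namespace PotentialExpansion

variable {P : PotentialExpansion} {m rh B E : ℝ} {x p : ℝ → E3}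

theorem IsReducedRay.cross_eq (h : P.IsReducedRay m B E x p) {σ : ℝ} (hσ : σ ∈ Iic B) :
    cross (x σ) (p σ) = cross (x B) (p B) := by
  refine eq_of_hasDerivWithinAt_zero (f := fun σ => cross (x σ) (p σ)) (fun s hs => ?_) hσ
  refine (crossL.hasDerivWithinAt_of_bilinear (h.deriv_x s hs) (h.deriv_p s hs)).congr_deriv ?_
  simp only [crossL_apply, cross_smul_right, cross_smul_left, cross_self_eq_zero, smul_zero,
    add_zero]

theorem IsReducedRay.continuousOn_norm (h : P.IsReducedRay m B E x p) :
    ContinuousOn (fun σ => ‖x σ‖) (Iic B) :=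
  fun σ hσ => (h.deriv_x σ hσ).continuousWithinAt.norm

theorem continuousOn_invB (hm : 0 < m) (hrh : 0 < rh) (hreg : P.RegularOutside m rh) :
    ContinuousOn (P.invB m) (Ioi rh) := fun r hr => by
  have hr0 : 0 < r := hrh.trans hr
  refine (hasDerivAt_powerSum_div (fun w hw => (hreg.summable hrh hw).2.1) hr0
    ?_).continuousAt.continuousWithinAt
  rw [abs_of_pos (by positivity)]
  exact div_lt_div_of_pos_left hm hrh hr

/-- With zero angular momentum the motion is radial, so the direction of `x` is constant. It would
equal its limit `-Ne`, making `n_B` parallel to `Ne`. -/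
theorem IsReducedRay.cross_ne_zero (h : P.IsReducedRay m B E x p) (hrh : 0 < rh)
    (hx : ∀ σ ∈ Iic B, rh < ‖x σ‖) {Ne : E3} (hNe : ‖Ne‖ = 1)
    (hxB : cross Ne (unitDir (x B)) ≠ 0)
    (h1 : Tendsto (fun σ => inner ℝ (x σ) Ne) atBot atBot)
    (h2 : ∃ p : E3, Tendsto (fun σ => x σ - inner ℝ (x σ) Ne • Ne) atBot (𝓝 p)) :
    cross (x B) (p B) ≠ 0 := by
  intro h0
  have hr : ∀ σ ∈ Iic B, 0 < ‖x σ‖ := fun σ hσ => hrh.trans (hx σ hσ)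
  have hconst : ∀ σ ∈ Iic B, unitDir (x σ) = unitDir (x B) := fun σ hσ => by
    refine eq_of_hasDerivWithinAt_zero (f := fun σ => unitDir (x σ)) (fun s hs => ?_) hσ
    have hrs := hr s hs
    have hd := h.deriv_x s hs
    refine (((hasDerivWithinAt_norm_of_ne_zero hd (norm_pos_iff.1 hrs)).inv hrs.ne').smul
      hd).congr_deriv ?_
    set lam := |E| / P.invB m ‖x s‖
    have hc : ‖x s‖ ^ 2 * ‖p s‖ ^ 2 - inner ℝ (x s) (p s) ^ 2 = 0 := by
      rw [← norm_cross_sq, h.cross_eq hs, h0, norm_zero]; norm_num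
    -- Equality case of Cauchy–Schwarz: `p` is its own projection on `x`.
    have hz : p s - (inner ℝ (x s) (p s) / ‖x s‖ ^ 2) • x s = 0 := by
      rw [← norm_eq_zero, ← sq_eq_zero_iff, norm_sub_sq_real, norm_smul, mul_pow,
        Real.norm_eq_abs, sq_abs, real_inner_smul_right, real_inner_comm (x s) (p s)]
      field_simp
      linear_combination hc
    rw [sub_eq_zero] at hz
    simp only [Pi.inv_apply, real_inner_smul_right]
    nth_rewrite 1 [hz]
    match_scalars
    field_simp
    ring
  have h3 := tendsto_unitDir_of_asymptote hNe h1 h2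
  have h4 : Tendsto (fun σ => unitDir (x σ)) atBot (𝓝 (unitDir (x B))) :=
    tendsto_const_nhds.congr' ((eventually_le_atBot B).mono fun σ hσ => (hconst σ hσ).symm)
  rw [tendsto_nhds_unique h4 h3, ← neg_one_smul ℝ, cross_smul_right, cross_self_eq_zero,
    smul_zero] at hxB
  exact hxB rfl

/-- This is `IsOrbitOn.closing` with `w = m / b`, `θ = arccos c` and `U B = b / r_B`. The cosine of
the swept angle is `n(σ) · n_B`, which tends to `-c`. -/
theorem IsReducedRay.impact_bound {w₀ M K c : ℝ} (h : P.IsReducedRay m B E x p) (hm : 0 < m)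
    (hrh : 0 < rh) (hreg : P.RegularOutside m rh) (hx : ∀ σ ∈ Iic B, rh < ‖x σ‖)
    {Ne : E3} (hNe : ‖Ne‖ = 1) (hxB : cross Ne (unitDir (x B)) ≠ 0)
    (hc : inner ℝ Ne (unitDir (x B)) = c)
    (h1 : Tendsto (fun σ => inner ℝ (x σ) Ne) atBot atBot)
    (h2 : ∃ p : E3, Tendsto (fun σ => x σ - inner ℝ (x σ) Ne • Ne) atBot (𝓝 p))
    (hM0 : 0 ≤ M) (hK0 : 0 ≤ K) (hF : ∀ v ∈ Icc 0 w₀, P.indexSq v ≤ 4)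
    (hM : ∀ v ∈ Icc 0 w₀, |deriv P.indexSq v| ≤ 2 * M)
    (hK : ∀ v ∈ Icc 0 w₀,
      |deriv P.indexSq v - 2 * (1 + P.γ) - 4 * P.kappa * v| ≤ K * v ^ 2)
    (hmB : m / ‖x B‖ ≤ w₀) (hw₀ : 2 * (m / ‖cross (x B) (p B)‖) < w₀)
    (hsmall : 16 * Real.pi * (m / ‖cross (x B) (p B)‖ * M) ≤ Real.sin (Real.arccos c / 2)) :
    |‖cross (x B) (p B)‖ / ‖x B‖ - (Real.sqrt (1 - c ^ 2)
        + (1 + P.γ) * (m / ‖cross (x B) (p B)‖) * (1 + c)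
        + P.kappa * (m / ‖cross (x B) (p B)‖) ^ 2 *
          (Real.sqrt (1 - c ^ 2) + (Real.pi - Real.arccos c) * c))|
      ≤ 2 * (2 * Real.pi) * (2 * K + 4 * |P.kappa| * M * (2 * Real.pi))
        * (m / ‖cross (x B) (p B)‖) ^ 3 := by
  have hb0 := norm_pos_iff.2 (h.cross_ne_zero hrh hx hNe hxB h1 h2)
  set b := ‖cross (x B) (p B)‖ with hb
  have hr : ∀ σ ∈ Iic B, 0 < ‖x σ‖ := fun σ hσ => hrh.trans (hx σ hσ)
  have hS : ∀ σ ∈ Iic B, 0 < P.invB m ‖x σ‖ := fun σ hσ => (hreg _ (hx σ hσ)).2.2.2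
  have hE := abs_pos.2 h.energy_ne_zero
  have hc1 : c ∈ Ioo (-1 : ℝ) 1 := by
    rw [← hc]
    exact inner_bounds_of_cross_ne_zero hNe (norm_unitDir (norm_pos_iff.1 (hr B self_mem_Iic))) hxB
  obtain ⟨U, V, φ, ω, horb, hU, hen, hcos⟩ := exists_orbit (m := m) (b := b)
    (lam := fun σ => |E| / P.invB m ‖x σ‖) (H := deriv P.indexSq) h.deriv_x h.deriv_p
    (fun σ hσ => norm_pos_iff.1 (hr σ hσ)) (fun σ hσ => div_pos hE (hS σ hσ))
    (continuousOn_const.div ((continuousOn_invB hm hrh hreg).comp h.continuousOn_norm hx)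
      fun σ hσ => (hS σ hσ).ne') (fun σ hσ => rfl) hb0
    (fun σ hσ => by rw [← norm_cross_sq, h.cross_eq hσ])
  have hwU : ∀ σ, m / b * U σ = m / ‖x σ‖ := fun σ => by
    rw [hU]
    field_simp
  have hθ : Real.arccos c ∈ Ioo 0 Real.pi := by
    refine ⟨Real.arccos_pos.2 hc1.2, lt_of_le_of_ne (Real.arccos_le_pi c) fun h0 => ?_⟩
    have := Real.arccos_eq_pi.1 h0
    linarith [hc1.1]
  have key := horb.closing (F := P.indexSq) (w₀ := w₀) (M := M) (g := 1 + P.γ) (κ := P.kappa)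
    (K := K) (θ := Real.arccos c)
    (fun σ hσ => by rw [hwU, hen σ hσ, h.norm_sq σ hσ]) hF
    (P.tendsto_indexSq (R := m / rh) (by positivity) (fun w hw => (hreg.summable hrh hw).1)
      fun w hw => (hreg.summable hrh hw).2.1) hM0 hM hK0 hK (div_pos hm hb0) hw₀ hθ hsmall
    (by rw [hwU]; exact hmB)
    (by
      have := (tendsto_norm_of_asymptote hNe h1).inv_tendsto_atTop.const_mul b
      rw [mul_zero] at this
      exact this.congr fun σ => (hU σ).symm)
    (by
      have h3 := (tendsto_unitDir_of_asymptote hNe h1 h2).inner (𝕜 := ℝ)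
        (tendsto_const_nhds (x := unitDir (x B)))
      rw [inner_neg_left, hc] at h3
      rw [Real.cos_arccos hc1.1.le hc1.2.le]
      exact h3.congr' ((eventually_le_atBot B).mono fun σ hσ => (hcos σ hσ).symm))
  rw [Real.sin_pi_sub, Real.cos_pi_sub, Real.sin_arccos, Real.cos_arccos hc1.1.le hc1.2.le, hU]
    at key
  convert key using 3
  ring

end PotentialExpansion

/-! ### Dependence on the mass parameter -/

/-- A convergent power series without constant term, with vector coefficients, is continuous up to
the origin. -/
theorem exists_continuousOn_of_hasSum {V : Type*} [NormedAddCommGroup V] [NormedSpace ℝ V]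
    [CompleteSpace V] {c : ℕ → V} {S : ℝ → V} {m₀ m₁ : ℝ}
    (h : ∀ m ∈ Ioo 0 m₀, HasSum (fun n : ℕ => m ^ (n + 1) • c n) (S m)) (hm : m₁ ∈ Ioo 0 m₀) :
    ∃ g : ℝ → V, ContinuousOn g (Icc 0 m₁) ∧ g 0 = 0 ∧ ∀ m ∈ Ioc 0 m₁, g m = S m := by
  obtain ⟨m₂, h12, h20⟩ := exists_between hm.2
  have hm1 := hm.1
  have hm2 : 0 < m₂ := hm1.trans h12
  obtain ⟨M, hM⟩ := ((h m₂ ⟨hm2, h20⟩).summable.tendsto_atTop_zero.norm).bddAbove_range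
  refine ⟨fun m => ∑' n : ℕ, m ^ (n + 1) • c n, ?_, by simp, fun m hmm =>
    (h m ⟨hmm.1, hmm.2.trans_lt hm.2⟩).tsum_eq⟩
  refine continuousOn_tsum (u := fun n : ℕ => M * (m₁ / m₂) ^ (n + 1))
    (fun n => by fun_prop) ?_ fun n m hmm => ?_
  · refine Summable.mul_left _ ((summable_nat_add_iff 1).2
      (summable_geometric_of_lt_one (by positivity) ((div_lt_one hm2).2 h12)))
  · have h1 : ‖m₂ ^ (n + 1) • c n‖ ≤ M := hM ⟨n, rfl⟩
    rw [norm_smul, norm_pow, Real.norm_of_nonneg hm2.le] at h1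
    rw [norm_smul, norm_pow, Real.norm_of_nonneg hmm.1, div_pow, mul_div_assoc',
      le_div_iff₀ (by positivity)]
    have h2 : m ^ (n + 1) ≤ m₁ ^ (n + 1) := pow_le_pow_left₀ hmm.1 hmm.2 _
    calc m ^ (n + 1) * ‖c n‖ * m₂ ^ (n + 1) = m ^ (n + 1) * (m₂ ^ (n + 1) * ‖c n‖) := by ring
      _ ≤ m₁ ^ (n + 1) * M := by
        have := (norm_nonneg _).trans (hM ⟨n, rfl⟩ : ‖m₂ ^ (n + 1) • c n‖ ≤ M)
        gcongr
      _ = _ := by ring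

namespace PotentialExpansion

variable {P : PotentialExpansion}

/-- Uniform bounds for the potentials in the region `m / r ≤ u` strictly inside the domain of
regularity. -/
theorem exists_potential_bound {R u : ℝ}
    (h : ∀ w ∈ Ioo 0 R, (Summable fun n : ℕ => P.a n * w ^ n) ∧
      (Summable fun n : ℕ => P.e n * w ^ n) ∧ 0 < powerSum P.a w ∧ 0 < powerSum P.e w)
    (hu : u < R) :
    ∃ N, 1 ≤ N ∧ ∀ w ∈ Icc 0 u, powerSum P.a w ≤ N ∧ (powerSum P.e w)⁻¹ ≤ N ∧
      |deriv (powerSum P.e) w| ≤ N ∧ P.indexSq w ≤ N ∧ |deriv P.indexSq w| ≤ N := by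
  have habs : ∀ w ∈ Icc 0 u, |w| < R := fun w hw => by
    rw [abs_of_nonneg hw.1]; exact hw.2.trans_lt hu
  have ha : ∀ w ∈ Icc 0 u, AnalyticAt ℝ (powerSum P.a) w := fun w hw =>
    powerSum_analyticAt (fun v hv => (h v hv).1) (habs w hw)
  have he : ∀ w ∈ Icc 0 u, AnalyticAt ℝ (powerSum P.e) w := fun w hw =>
    powerSum_analyticAt (fun v hv => (h v hv).2.1) (habs w hw)
  have hpos : ∀ w ∈ Icc 0 u, 0 < powerSum P.a w ∧ 0 < powerSum P.e w := fun w hw => by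
    rcases hw.1.eq_or_lt with h0 | h0
    · rw [← h0, P.powerSum_a_zero, P.powerSum_e_zero]; norm_num
    · exact (h w ⟨h0, hw.2.trans_lt hu⟩).2.2
  have hi : ∀ w ∈ Icc 0 u, AnalyticAt ℝ P.indexSq w := fun w hw =>
    (he w hw).div (ha w hw) (hpos w hw).1.ne'
  have bd : ∀ f : ℝ → ℝ, (∀ w ∈ Icc 0 u, ContinuousAt f w) → ∃ N, ∀ w ∈ Icc 0 u, |f w| ≤ N :=
    fun f hf => isCompact_Icc.exists_bound_of_continuousOn
      fun w hw => (hf w hw).continuousWithinAt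
  obtain ⟨N₁, h1⟩ := bd _ fun w hw => (ha w hw).continuousAt
  obtain ⟨N₂, h2⟩ := bd (fun w => (powerSum P.e w)⁻¹)
    fun w hw => (he w hw).continuousAt.inv₀ (hpos w hw).2.ne'
  obtain ⟨N₃, h3⟩ := bd _ fun w hw => (he w hw).deriv.continuousAt
  obtain ⟨N₄, h4⟩ := bd _ fun w hw => (hi w hw).continuousAt
  obtain ⟨N₅, h5⟩ := bd _ fun w hw => (hi w hw).deriv.continuousAt
  have a1 := abs_nonneg N₁
  have a2 := abs_nonneg N₂
  have a3 := abs_nonneg N₃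
  have a4 := abs_nonneg N₄
  have a5 := abs_nonneg N₅
  refine ⟨1 + |N₁| + |N₂| + |N₃| + |N₄| + |N₅|, by linarith, fun w hw => ?_⟩
  have b1 := (h1 w hw).trans (le_abs_self N₁)
  have b2 := (h2 w hw).trans (le_abs_self N₂)
  have b3 := (h3 w hw).trans (le_abs_self N₃)
  have b4 := (h4 w hw).trans (le_abs_self N₄)
  have b5 := (h5 w hw).trans (le_abs_self N₅)
  exact ⟨by linarith [le_abs_self (powerSum P.a w)], by linarith [le_abs_self ((powerSum P.e w)⁻¹)],
    by linarith, by linarith [le_abs_self (P.indexSq w)], by linarith⟩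

/-- The velocity of a reduced ray is Lipschitz, with a constant controlled by bounds for the
potentials and the energy. -/
theorem IsReducedRay.norm_chord_sub_le {m m₁ rh B E e N : ℝ} {x p : ℝ → E3}
    (h : P.IsReducedRay m B E x p) (hm : 0 < m) (hm₁ : m ≤ m₁) (hrh : 0 < rh)
    (hreg : P.RegularOutside m rh) (hx : ∀ σ ∈ Iic B, rh < ‖x σ‖) (hE : |E| ≤ e) (hN1 : 1 ≤ N)
    (hN : ∀ w ∈ Icc 0 (m₁ / rh), powerSum P.a w ≤ N ∧ (powerSum P.e w)⁻¹ ≤ N ∧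
      |deriv (powerSum P.e) w| ≤ N ∧ P.indexSq w ≤ N ∧ |deriv P.indexSq w| ≤ N)
    {s : ℝ} (hs : s ≤ B) :
    ‖x B - x s - (B - s) • derivWithin x (Iic B) B‖
      ≤ (e ^ 2 * N ^ 6 * (m₁ / rh ^ 2) + e ^ 2 * N ^ 3 * (m₁ / rh ^ 2)) * (B - s) * (B - s) := by
  set lam : ℝ → ℝ := fun σ => |E| / P.invB m ‖x σ‖ with hlam
  have he : 0 ≤ e := (abs_nonneg E).trans hE
  have hN0 : 0 ≤ N := zero_le_one.trans hN1
  have hm1 : 0 < m₁ := hm.trans_le hm₁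
  have hr : ∀ σ ∈ Iic B, 0 < ‖x σ‖ := fun σ hσ => hrh.trans (hx σ hσ)
  have hw : ∀ σ ∈ Iic B, m / ‖x σ‖ ∈ Icc 0 (m₁ / rh) := fun σ hσ => by
    have := hr σ hσ
    exact ⟨by positivity, div_le_div₀ hm1.le hm₁ hrh (hx σ hσ).le⟩
  have hwR : ∀ σ ∈ Iic B, |m / ‖x σ‖| < m / rh := fun σ hσ => by
    rw [abs_of_nonneg (hw σ hσ).1]
    exact div_lt_div_of_pos_left hm hrh (hx σ hσ)
  have hS : ∀ σ ∈ Iic B, 0 < P.invB m ‖x σ‖ := fun σ hσ => (hreg _ (hx σ hσ)).2.2.2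
  have hSN : ∀ σ ∈ Iic B, (P.invB m ‖x σ‖)⁻¹ ≤ N := fun σ hσ => (hN _ (hw σ hσ)).2.1
  have hlam0 : ∀ σ ∈ Iic B, 0 ≤ lam σ := fun σ hσ => div_nonneg (abs_nonneg _) (hS σ hσ).le
  have hlamN : ∀ σ ∈ Iic B, lam σ ≤ e * N := fun σ hσ => by
    rw [hlam]
    simp only [div_eq_mul_inv]
    exact mul_le_mul hE (hSN σ hσ) (inv_nonneg.2 (hS σ hσ).le) he
  have hpN : ∀ σ ∈ Iic B, ‖p σ‖ ≤ N := fun σ hσ => by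
    have h1 := (hN _ (hw σ hσ)).2.2.2.1
    rw [← h.norm_sq σ hσ] at h1
    nlinarith [norm_nonneg (p σ)]
  have hq : ∀ σ ∈ Iic B, m / ‖x σ‖ ^ 2 ≤ m₁ / rh ^ 2 := fun σ hσ =>
    div_le_div₀ hm1.le hm₁ (by positivity) (pow_le_pow_left₀ hrh.le (hx σ hσ).le 2)
  have hlamd : ∀ σ ∈ Iic B, ∃ d, HasDerivWithinAt lam d (Iic B) σ ∧
      |d| ≤ e ^ 2 * N ^ 5 * (m₁ / rh ^ 2) := fun σ hσ => by
    have hrσ := hr σ hσ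
    have hSσ := hS σ hσ
    have d1 := hasDerivWithinAt_norm_of_ne_zero (h.deriv_x σ hσ) (norm_pos_iff.1 hrσ)
    have d2 : HasDerivAt (P.invB m) _ ‖x σ‖ :=
      hasDerivAt_powerSum_div (fun w hw => (hreg.summable hrh hw).2.1) hrσ (hwR σ hσ)
    have d4 : HasDerivWithinAt (fun s => P.invB m ‖x s‖) _ (Iic B) σ :=
      HasDerivAt.comp_hasDerivWithinAt (h₂ := P.invB m) σ d2 d1
    have d3 := (d4.fun_inv hSσ.ne').const_mul |E|
    refine ⟨_, d3, ?_⟩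
    have g1 : |inner ℝ (x σ) (lam σ • p σ) / ‖x σ‖| ≤ e * N * N := by
      rw [abs_div, abs_norm, div_le_iff₀ hrσ]
      refine (abs_real_inner_le_norm _ _).trans ?_
      rw [norm_smul, Real.norm_of_nonneg (hlam0 σ hσ), mul_comm]
      have := mul_le_mul (hlamN σ hσ) (hpN σ hσ) (norm_nonneg _) (by positivity)
      gcongr
    have g2 : |-m / ‖x σ‖ ^ 2| ≤ m₁ / rh ^ 2 := by
      rw [neg_div, abs_neg, abs_of_nonneg (by positivity)]
      exact hq σ hσ
    have g3 := (hN _ (hw σ hσ)).2.2.1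
    have e1 : ∀ u v z : ℝ, |E| * (-(u * v * z) / P.invB m ‖x σ‖ ^ 2)
        = -(|E| * (u * v * z) * ((P.invB m ‖x σ‖)⁻¹ * (P.invB m ‖x σ‖)⁻¹)) := fun u v z => by
      field_simp
    rw [e1, abs_neg, abs_mul, abs_mul, abs_mul, abs_mul, abs_abs, abs_mul,
      abs_of_nonneg (inv_nonneg.2 hSσ.le)]
    have hi := inv_nonneg.2 hSσ.le
    calc _ ≤ e * (N * (m₁ / rh ^ 2) * (e * N * N)) * (N * N) := by
          gcongr
          · exact hSN σ hσ
          · exact hSN σ hσ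
      _ = _ := by ring
  have hdx : ∀ σ ∈ Iic B, derivWithin x (Iic B) σ = lam σ • p σ := fun σ hσ =>
    (h.deriv_x σ hσ).derivWithin (uniqueDiffOn_Iic B σ hσ)
  -- The two summands bound `lam' p` and `lam p'`, the parts of the derivative of the velocity `lam
  -- p`.
  set C := e ^ 2 * N ^ 6 * (m₁ / rh ^ 2) + e ^ 2 * N ^ 3 * (m₁ / rh ^ 2) with hC
  have hC0 : 0 ≤ C := by positivity
  have hlip : ∀ σ ∈ Iic B, ‖lam σ • p σ - lam B • p B‖ ≤ C * (B - σ) := fun σ hσ => by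
    choose! d hd1 hd2 using hlamd
    have := (convex_Iic B).norm_image_sub_le_of_norm_hasDerivWithin_le (C := C)
      (fun τ hτ => (hd1 τ hτ).smul (h.deriv_p τ hτ)) (fun τ hτ => ?_) self_mem_Iic hσ
    · rw [Real.norm_eq_abs, abs_sub_comm, abs_of_nonneg (sub_nonneg.2 hσ)] at this
      exact this
    · have hrτ := hr τ hτ
      refine (norm_add_le _ _).trans ?_
      rw [add_comm]
      refine add_le_add ?_ ?_
      · rw [norm_smul, Real.norm_eq_abs]
        calc _ ≤ e ^ 2 * N ^ 5 * (m₁ / rh ^ 2) * N := by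
              have h1 := hd2 τ hτ
              have h2 := hpN τ hτ
              gcongr
          _ = _ := by ring
      · have hl0 := hlam0 τ hτ
        have hlN := hlamN τ hτ
        have hH := (hN _ (hw τ hτ)).2.2.2.2
        have hqτ := hq τ hτ
        rw [norm_smul, norm_smul, Real.norm_of_nonneg hl0, norm_neg, Real.norm_eq_abs]
        change lam τ * (|lam τ / 2 * m * deriv P.indexSq (m / ‖x τ‖) / ‖x τ‖ ^ 3| * ‖x τ‖) ≤ _
        have e1 : |lam τ / 2 * m * deriv P.indexSq (m / ‖x τ‖) / ‖x τ‖ ^ 3| * ‖x τ‖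
            = lam τ / 2 * |deriv P.indexSq (m / ‖x τ‖)| * (m / ‖x τ‖ ^ 2) := by
          rw [abs_div, abs_mul, abs_of_nonneg (by positivity : 0 ≤ lam τ / 2 * m),
            abs_of_pos (by positivity : 0 < ‖x τ‖ ^ 3)]
          field_simp
        rw [e1]
        calc _ ≤ (e * N) * ((e * N) / 2 * N * (m₁ / rh ^ 2)) := by gcongr
          _ ≤ _ := by
            have : 0 ≤ e ^ 2 * N ^ 3 * (m₁ / rh ^ 2) := by positivity
            linarith
  have hsub : Icc s B ⊆ Iic B := Icc_subset_Iic_self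
  have key := (convex_Icc s B).norm_image_sub_le_of_norm_hasDerivWithin_le (C := C * (B - s))
    (f := fun σ => x σ - σ • (lam B • p B)) (f' := fun σ => lam σ • p σ - (1 : ℝ) • (lam B • p B))
    (fun τ hτ => ((h.deriv_x τ (hsub hτ)).mono hsub).sub
      ((hasDerivWithinAt_id τ _).smul_const _))
    (fun τ hτ => by
      rw [one_smul]
      refine (hlip τ (hsub hτ)).trans (mul_le_mul_of_nonneg_left ?_ hC0)
      linarith [hτ.1]) (left_mem_Icc.2 hs) (right_mem_Icc.2 hs)
  rw [Real.norm_of_nonneg (sub_nonneg.2 hs)] at key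
  rw [hdx B self_mem_Iic]
  have e2 : x B - x s - (B - s) • lam B • p B
      = x B - B • (lam B • p B) - (x s - s • (lam B • p B)) := by module
  rw [e2]
  exact key

end PotentialExpansion

/-! ### The family of rays -/

namespace PotentialExpansion

variable {P : PotentialExpansion}

namespace QuasiMinkowskianRay

variable {rh m₀ : ℝ} {Ne xB : E3} (Γ : P.QuasiMinkowskianRay rh m₀ Ne xB)

theorem pos_σB {m : ℝ} (hm : m ∈ Ioo 0 m₀) : Γ.pos m Γ.σB = xB := by
  have h := Γ.hasSum_pos m hm Γ.σB self_mem_Iic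
  simp only [Γ.coefPos_σB, smul_zero, sub_self, zero_smul, add_zero] at h
  exact sub_eq_zero.1 (h.unique hasSum_zero)

theorem time_σB {m : ℝ} (hm : m ∈ Ioo 0 m₀) : Γ.time m Γ.σB = Γ.tB := by
  have h := Γ.hasSum_time m hm Γ.σB self_mem_Iic
  simp only [Γ.coefTime_σB, mul_zero, sub_self, add_zero] at h
  exact sub_eq_zero.1 (h.unique hasSum_zero)

/-- The velocity at the point of reception is continuous in the mass parameter, up to the
Minkowskian limit. -/
theorem exists_continuousOn_velocity (hrh : 0 < rh)
    (hreg : ∀ m ∈ Ioo 0 m₀, P.RegularOutside m rh) {m₁ : ℝ} (hm₁ : m₁ ∈ Ioo 0 m₀) :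
    ∃ f : ℝ → E3, ContinuousOn f (Icc 0 m₁) ∧ f 0 = Ne ∧
      ∀ m ∈ Ioc 0 m₁, f m = derivWithin (Γ.pos m) (Iic Γ.σB) Γ.σB := by
  have hmem : ∀ m ∈ Ioc 0 m₁, m ∈ Ioo 0 m₀ := fun m hm => ⟨hm.1, hm.2.trans_lt hm₁.2⟩
  obtain ⟨m₂, h12, h20⟩ := exists_between hm₁.2
  have hm2 : m₂ ∈ Ioo 0 m₀ := ⟨hm₁.1.trans h12, h20⟩
  obtain ⟨N, hN1, hN⟩ := exists_potential_bound (P := P) (R := m₂ / rh) (u := m₁ / rh)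
    (fun w hw => (hreg m₂ hm2).summable hrh hw) (div_lt_div_of_pos_right h12 hrh)
  obtain ⟨gt, hgtc, -, hgt⟩ := exists_continuousOn_of_hasSum
    (fun m hm => Γ.hasSum_time m hm (Γ.σB - 1) (by simp)) hm₁
  obtain ⟨T, hT⟩ := isCompact_Icc.exists_bound_of_continuousOn hgtc
  -- Uniform energy bound: at some point of the last unit interval `dt/dσ` equals the mean slope of
  -- the time, which the power series bounds uniformly in `m`.
  have hred : ∀ m ∈ Ioc 0 m₁, ∃ E p, |E| ≤ N * (1 + T) ∧ P.IsReducedRay m Γ.σB E (Γ.pos m) p := by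
    intro m hm
    have hm' := hmem m hm
    have hgeo := Γ.isNullGeodesic m hm'
    obtain ⟨E, hE, hray⟩ := hgeo.isReducedRay hm.1 hrh (hreg m hm') (Γ.mem_region m hm')
    refine ⟨E, _, ?_, hray⟩
    have hlt : Γ.σB - 1 < Γ.σB := by linarith
    obtain ⟨ξ, hξ, hs⟩ := exists_hasDerivAt_eq_slope (Γ.time m)
      (fun σ => derivWithin (Γ.time m) (Iic Γ.σB) σ) hlt
      (fun σ hσ => ((hgeo.differentiable_time σ hσ.2).continuousWithinAt).mono
        Icc_subset_Iic_self)
      (fun σ hσ => ((hgeo.differentiable_time σ hσ.2.le).hasDerivWithinAt).hasDerivAt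
        (Iic_mem_nhds hσ.2))
    have hgm := hT m ⟨hm.1.le, hm.2⟩
    rw [hgt m hm, Real.norm_eq_abs] at hgm
    rw [Γ.time_σB hm', sub_sub_cancel, div_one] at hs
    have hd : |derivWithin (Γ.time m) (Iic Γ.σB) ξ| ≤ 1 + T := by
      rw [hs, show Γ.tB - Γ.time m (Γ.σB - 1)
        = 1 + -(Γ.time m (Γ.σB - 1) - (Γ.tB + (Γ.σB - 1 - Γ.σB))) by ring]
      refine (abs_add_le _ _).trans ?_
      rw [abs_one, abs_neg]
      linarith
    have hξr := Γ.mem_region m hm' ξ hξ.2.le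
    have hA := ((hreg m hm') _ hξr).2.2.1
    have hAN : P.potA m ‖Γ.pos m ξ‖ ≤ N := (hN (m / ‖Γ.pos m ξ‖)
      ⟨div_nonneg hm.1.le (norm_nonneg _), div_le_div₀ hm₁.1.le hm.2 hrh hξr.le⟩).1
    rw [← hE ξ hξ.2.le, abs_mul, abs_of_pos hA]
    exact mul_le_mul hAN hd (abs_nonneg _) (zero_le_one.trans hN1)
  set C := (N * (1 + T)) ^ 2 * N ^ 6 * (m₁ / rh ^ 2) + (N * (1 + T)) ^ 2 * N ^ 3 * (m₁ / rh ^ 2)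
    with hC
  have hC0 : 0 ≤ C := by
    have := hm₁.1
    have := zero_le_one.trans hN1
    positivity
  set f : ℝ → E3 := fun m => if m = 0 then Ne else derivWithin (Γ.pos m) (Iic Γ.σB) Γ.σB with hf
  refine ⟨f, ?_, by simp [hf], fun m hm => by simp [hf, hm.1.ne']⟩
  -- The velocity is a uniform limit of chord slopes. For a fixed step `h` the slope is `Ne - g m /
  -- h`, continuous in `m`, and it differs from the velocity by at most `C h`.
  refine continuousOn_of_uniform_approx_of_continuousOn fun u hu => ?_
  obtain ⟨r, hr, hru⟩ := Metric.mem_uniformity_dist.1 hu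
  set h : ℝ := r / (C + 1) with hh
  have hh0 : 0 < h := by positivity
  obtain ⟨g, hgc, hg0, hg⟩ := exists_continuousOn_of_hasSum
    (fun m hm => Γ.hasSum_pos m hm (Γ.σB - h) (by simp [hh0.le])) hm₁
  refine ⟨fun m => Ne - h⁻¹ • g m, continuousOn_const.sub (hgc.const_smul h⁻¹ :
    ContinuousOn (fun m => h⁻¹ • g m) _), fun m hm => hru ?_⟩
  rcases hm.1.eq_or_lt with h0 | h0
  · rw [← h0]
    simpa [hf, hg0] using hr
  · have hm' : m ∈ Ioc 0 m₁ := ⟨h0, hm.2⟩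
    obtain ⟨E, p, hE, hray⟩ := hred m hm'
    have key := hray.norm_chord_sub_le h0 hm.2 hrh (hreg m (hmem m hm'))
      (Γ.mem_region m (hmem m hm')) hE hN1 hN (show Γ.σB - h ≤ Γ.σB by linarith)
    rw [sub_sub_cancel, ← hC, Γ.pos_σB (hmem m hm')] at key
    have e : f m - (Ne - h⁻¹ • g m)
        = -(h⁻¹ • (xB - Γ.pos m (Γ.σB - h) - h • derivWithin (Γ.pos m) (Iic Γ.σB) Γ.σB)) := by
      rw [hg m hm']
      simp only [hf, h0.ne', if_false]
      match_scalars <;> field_simp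
      ring
    rw [dist_eq_norm, e, norm_neg, norm_smul, norm_inv, Real.norm_of_nonneg hh0.le]
    calc h⁻¹ * _ ≤ h⁻¹ * (C * h * h) := mul_le_mul_of_nonneg_left key (by positivity)
      _ = C * h := by field_simp
      _ < (C + 1) * h := by linarith
      _ = r := by rw [hh]; field_simp

/-- Everything that is needed about the ray of a given mass parameter. -/
theorem exists_isReducedRay (hrh : 0 < rh) (hreg : ∀ m ∈ Ioo 0 m₀, P.RegularOutside m rh) {m : ℝ}
    (hm : m ∈ Ioo 0 m₀) :
    ∃ E p, P.IsReducedRay m Γ.σB E (Γ.pos m) p ∧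
      (∃ c : ℝ, |c| = 1 ∧ ∀ σ ∈ Iic Γ.σB, Γ.L m σ = c • cross (Γ.pos m σ) (p σ)) ∧
      ∃ c : ℝ, 0 < c ∧ p Γ.σB = c • derivWithin (Γ.pos m) (Iic Γ.σB) Γ.σB := by
  obtain ⟨E, hE, hray⟩ := (Γ.isNullGeodesic m hm).isReducedRay hm.1 hrh (hreg m hm)
    (Γ.mem_region m hm)
  have hE0 := hray.energy_ne_zero
  refine ⟨E, _, hray, ⟨|E| / E, ?_, fun σ hσ => ?_⟩, |E|⁻¹ * P.invB m ‖Γ.pos m Γ.σB‖, ?_, ?_⟩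
  · rw [abs_div, abs_abs, div_self (abs_ne_zero.2 hE0)]
  · rw [L, angularMomentum, directionTriple, hE σ hσ]
    simp only [← neg_smul, cross_smul_right, smul_smul]
    congr 1
    have := abs_ne_zero.2 hE0
    field_simp
  · have := ((hreg m hm) _ (Γ.mem_region m hm Γ.σB self_mem_Iic)).2.2.2
    have := abs_pos.2 hE0
    positivity
  · rw [smul_smul]

theorem L_eq (hrh : 0 < rh) (hreg : ∀ m ∈ Ioo 0 m₀, P.RegularOutside m rh) {m : ℝ}
    (hm : m ∈ Ioo 0 m₀) {σ : ℝ} (hσ : σ ≤ Γ.σB) : Γ.L m σ = Γ.L m Γ.σB := by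
  obtain ⟨E, p, hray, ⟨c, -, hc⟩, -⟩ := Γ.exists_isReducedRay hrh hreg hm
  rw [hc σ hσ, hc Γ.σB self_mem_Iic, hray.cross_eq hσ]

/-- The ratio of the mass parameter to the impact parameter, as a continuous function of the
mass parameter. -/
theorem exists_continuousOn_ratio (hrh : 0 < rh)
    (hreg : ∀ m ∈ Ioo 0 m₀, P.RegularOutside m rh) (hxB : cross Ne (unitDir xB) ≠ 0)
    (hb : ∀ m ∈ Ioo 0 m₀, 0 < Γ.impactParameter m) {m₁ : ℝ} (hm₁ : m₁ ∈ Ioo 0 m₀) :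
    ∃ g : ℝ → ℝ, ContinuousOn g (Icc 0 m₁) ∧ g 0 = 0 ∧
      ∀ m ∈ Ioc 0 m₁, g m = m / Γ.impactParameter m := by
  obtain ⟨f, hfc, hf0, hf⟩ := Γ.exists_continuousOn_velocity hrh hreg hm₁
  have hmem : ∀ m ∈ Ioc 0 m₁, m ∈ Ioo 0 m₀ := fun m hm => ⟨hm.1, hm.2.trans_lt hm₁.2⟩
  have hr : rh < ‖xB‖ := by
    rw [← Γ.pos_σB hm₁]
    exact Γ.mem_region m₁ hm₁ Γ.σB self_mem_Iic
  have hr0 := hrh.trans hr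
  obtain ⟨m₂, h12, h20⟩ := exists_between hm₁.2
  have hm2 : m₂ ∈ Ioo 0 m₀ := ⟨hm₁.1.trans h12, h20⟩
  -- `p` is a positive multiple of the velocity `f m` and its length is known from `indexSq`, so `b
  -- ‖f m‖ = D m`. Unlike `b`, `D` makes sense at `m = 0`, where it is `‖xB × Ne‖`.
  set D : ℝ → ℝ := fun m => Real.sqrt (P.indexSq (m / ‖xB‖)) * ‖cross xB (f m)‖ with hD
  have hDm : ∀ m ∈ Ioc 0 m₁, D m = Γ.impactParameter m * ‖f m‖ ∧ f m ≠ 0 := fun m hm => by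
    obtain ⟨E, p, hray, ⟨c, hc1, hc⟩, d, hd, hp⟩ := Γ.exists_isReducedRay hrh hreg (hmem m hm)
    rw [← hf m hm] at hp
    have h1 := hray.norm_sq Γ.σB self_mem_Iic
    have hbm := hb m (hmem m hm)
    rw [impactParameter, hc Γ.σB self_mem_Iic, norm_smul, Real.norm_eq_abs, hc1, one_mul, hp,
      Γ.pos_σB (hmem m hm), cross_smul_right, norm_smul, Real.norm_of_nonneg hd.le] at hbm
    rw [Γ.pos_σB (hmem m hm)] at h1
    refine ⟨?_, fun h0 => ?_⟩
    · rw [hD, impactParameter, hc Γ.σB self_mem_Iic, norm_smul, Real.norm_eq_abs, hc1, one_mul, hp,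
        Γ.pos_σB (hmem m hm), cross_smul_right, norm_smul, Real.norm_of_nonneg hd.le]
      simp only
      rw [← h1, Real.sqrt_sq (norm_nonneg _), hp, norm_smul, Real.norm_of_nonneg hd.le]
      ring
    · rw [h0, ← zero_smul ℝ (0 : E3), cross_smul_right, zero_smul, norm_zero, mul_zero] at hbm
      exact hbm.false
  refine ⟨fun m => m * ‖f m‖ / D m, ?_, by simp, fun m hm => ?_⟩
  · have hcrossc : ContinuousOn (fun m => ‖cross xB (f m)‖) (Icc 0 m₁) :=
      (continuous_cross.comp_continuousOn (continuousOn_const.prodMk hfc)).norm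
    have hIc : ContinuousOn (fun m => P.indexSq (m / ‖xB‖)) (Icc 0 m₁) := fun m hm => by
      have hw : |m / ‖xB‖| < m₂ / rh := by
        rw [abs_of_nonneg (div_nonneg hm.1 hr0.le)]
        exact (div_le_div₀ hm2.1.le (hm.2.trans h12.le) hrh hr.le).lt_of_ne fun he => by
          rw [div_eq_div_iff hr0.ne' hrh.ne'] at he
          have : m * rh < m₂ * ‖xB‖ :=
            mul_lt_mul'' (hm.2.trans_lt h12) hr hm.1 hrh.le
          linarith
      have hne : powerSum P.a (m / ‖xB‖) ≠ 0 := by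
        rcases hm.1.eq_or_lt with h0 | h0
        · rw [← h0, zero_div, P.powerSum_a_zero]; norm_num
        · exact ((hreg m (hmem m ⟨h0, hm.2⟩)) _ hr).2.2.1.ne'
      have h1 : ContinuousAt P.indexSq (m / ‖xB‖) :=
        (powerSum_analyticAt (fun w hw => ((hreg m₂ hm2).summable hrh hw).2.1) hw).continuousAt.div
          (powerSum_analyticAt (fun w hw => ((hreg m₂ hm2).summable hrh hw).1) hw).continuousAt hne
      exact (ContinuousAt.comp (f := fun m => m / ‖xB‖) h1
        (continuous_id.div_const _).continuousAt).continuousWithinAt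
    refine (continuousOn_id.mul hfc.norm).div (hIc.sqrt.mul hcrossc) fun m hm => ?_
    rcases hm.1.eq_or_lt with h0 | h0
    · change Real.sqrt (P.indexSq (m / ‖xB‖)) * ‖cross xB (f m)‖ ≠ 0
      rw [← h0, zero_div, hf0, indexSq, P.powerSum_a_zero, P.powerSum_e_zero, div_one, Real.sqrt_one,
        one_mul, norm_ne_zero_iff]
      intro hz
      apply hxB
      have h2 := norm_cross_sq xB Ne
      rw [hz, norm_zero, real_inner_comm] at h2
      rw [← norm_eq_zero, ← sq_eq_zero_iff, unitDir, cross_smul_right, norm_smul, mul_pow,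
        norm_cross_sq]
      linear_combination (-‖‖xB‖⁻¹‖ ^ 2) * h2
    · obtain ⟨h1, h2⟩ := hDm m ⟨h0, hm.2⟩
      change D m ≠ 0
      rw [h1]
      exact mul_ne_zero (hb m (hmem m ⟨h0, hm.2⟩)).ne' (norm_ne_zero_iff.2 h2)
  · obtain ⟨h1, h2⟩ := hDm m hm
    simp only
    rw [h1]
    exact mul_div_mul_right _ _ (norm_ne_zero_iff.2 h2)

end QuasiMinkowskianRay

/-! ### The second order estimate -/

/-- Writing `s² = (1 - c)(1 + c)` turns `s / (1 - c)` into `(1 + c) / s`. The stated formula thereby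
takes the shape `1 + α μ + (k - α²) μ²` of `inversion_bound`. -/
theorem impactInfinity_eq {m c s : ℝ} {Ne xB : E3} (hc : inner ℝ Ne (unitDir xB) = c)
    (hs : ‖cross Ne (unitDir xB)‖ = s) (hs0 : 0 < s) (hsc : s ^ 2 = 1 - c ^ 2)
    (hr : rcInfinity Ne xB ≠ 0) :
    P.impactInfinity m Ne xB = rcInfinity Ne xB *
      (1 + (1 + P.γ) * (1 + c) / s * (m / rcInfinity Ne xB)
        + (P.kappa * (s + (Real.pi - Real.arccos c) * c) / s - ((1 + P.γ) * (1 + c) / s) ^ 2)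
          * (m / rcInfinity Ne xB) ^ 2) := by
  simp only [impactInfinity, hc, hs]
  have hc1 : 1 - c ≠ 0 := fun h => by
    have : c = 1 := by linarith
    rw [this] at hsc
    nlinarith
  have e1 : s / (1 - c) = (1 + c) / s := by
    rw [div_eq_div_iff hc1 hs0.ne']
    linear_combination hsc
  have e2 : (1 + c) / (1 - c) = (1 + c) ^ 2 / s ^ 2 := by
    rw [div_eq_div_iff hc1 (by positivity)]
    linear_combination (1 + c) * hsc
  rw [e1, e2]
  field_simp

set_option maxHeartbeats 1000000 in
/-- Second order estimate of the impact parameter, for a given direction of reception. -/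
theorem exists_impact_estimate (P : PotentialExpansion) {R : ℝ} (hR : 0 < R)
    (ha : ∀ w ∈ Ioo 0 R, Summable fun n : ℕ => P.a n * w ^ n)
    (he : ∀ w ∈ Ioo 0 R, Summable fun n : ℕ => P.e n * w ^ n) {c : ℝ} (hc : c ∈ Ioo (-1 : ℝ) 1) :
    ∃ C δ : ℝ, 0 < δ ∧ ∀ (rh m₀ : ℝ) (Ne xB : E3), 0 < rh →
      (∀ m ∈ Ioo 0 m₀, P.RegularOutside m rh) → ‖Ne‖ = 1 → cross Ne (unitDir xB) ≠ 0 →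
      inner ℝ Ne (unitDir xB) = c →
      ∀ Γ : P.QuasiMinkowskianRay rh m₀ Ne xB, ∀ m ∈ Ioo 0 m₀,
        m ≤ δ * rcInfinity Ne xB →
          |Γ.impactParameter m - P.impactInfinity m Ne xB| ≤ C * (m ^ 3 / rcInfinity Ne xB ^ 2) := by
  obtain ⟨w₀, M, K, hw₀, hM0, hK0, hF, hM, hK⟩ := P.indexSq_bounds hR ha he
  have hπ := Real.pi_pos
  set s := Real.sqrt (1 - c ^ 2) with hs
  have hs1 : 0 < 1 - c ^ 2 := by nlinarith [hc.1, hc.2]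
  have hs0 : 0 < s := Real.sqrt_pos.2 hs1
  have hsc : s ^ 2 = 1 - c ^ 2 := Real.sq_sqrt hs1.le
  have hsin : 0 < Real.sin (Real.arccos c / 2) := by
    have := Real.arccos_pos.2 hc.2
    exact Real.sin_pos_of_pos_of_lt_pi (by linarith) (by linarith [Real.arccos_le_pi c])
  set α := (1 + P.γ) * (1 + c) / s with hα
  set k := P.kappa * (s + (Real.pi - Real.arccos c) * c) / s with hk
  set C₁ := 2 * (2 * Real.pi) * (2 * K + 4 * |P.kappa| * M * (2 * Real.pi)) / s with hC₁
  have hC₁0 : 0 ≤ C₁ := by positivity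
  -- The four terms ensure in turn `2 w < w₀`, the smallness that excludes an extra turn, `w ≤ 1`,
  -- and `|b / r_c - 1| ≤ 1/2`.
  set δ₂ := min (min (w₀ / 4) (Real.sin (Real.arccos c / 2) / (16 * Real.pi * (M + 1))))
    (min 1 (1 / (2 * (|α| + |k| + C₁ + 1)))) with hδ₂
  have hδ₂0 : 0 < δ₂ := by positivity
  refine ⟨8 * (C₁ + |α| * (|k| + C₁) + (|k| + |α| ^ 2) * 3 * (|α| + |k| + C₁)),
    -- The bound `w₀` gives `m / r_B ≤ w₀`, since `r_c ≤ r_B`; the bound `δ₂ / 4` closes the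
    -- bootstrap `hsmall`.
    min w₀ (δ₂ / 4), by positivity, ?_⟩
  intro rh m₀ Ne xB hrh hreg hNe hxB hcc Γ m hm hle
  have hrB : rh < ‖xB‖ := by
    rw [← Γ.pos_σB hm]
    exact Γ.mem_region m hm Γ.σB self_mem_Iic
  have hr0 := hrh.trans hrB
  have hss : ‖cross Ne (unitDir xB)‖ = s := by
    have := norm_cross_sq Ne (unitDir xB)
    rw [hNe, norm_unitDir (norm_pos_iff.1 hr0), hcc] at this
    rw [hs, ← Real.sqrt_sq (norm_nonneg (cross _ _)), this]
    norm_num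
  have hrc : rcInfinity Ne xB = ‖xB‖ * s := by rw [rcInfinity, hss]
  set rc := rcInfinity Ne xB with hrcdef
  have hrc0 : 0 < rc := by rw [hrc]; positivity
  have hs_le : s ≤ 1 := by
    rw [hs]
    exact Real.sqrt_le_one.2 (by nlinarith [sq_nonneg c])
  have hred : ∀ m' ∈ Ioo 0 m₀, ∃ E p, P.IsReducedRay m' Γ.σB E (Γ.pos m') p ∧
      Γ.impactParameter m' = ‖cross (Γ.pos m' Γ.σB) (p Γ.σB)‖ := fun m' hm' => by
    obtain ⟨E, p, hray, ⟨d, hd1, hd⟩, -⟩ := Γ.exists_isReducedRay hrh hreg hm'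
    refine ⟨E, p, hray, ?_⟩
    rw [QuasiMinkowskianRay.impactParameter, hd Γ.σB self_mem_Iic, norm_smul, Real.norm_eq_abs,
      hd1, one_mul]
  have hb : ∀ m' ∈ Ioo 0 m₀, 0 < Γ.impactParameter m' := fun m' hm' => by
    obtain ⟨E, p, hray, hbp⟩ := hred m' hm'
    rw [hbp, norm_pos_iff]
    exact hray.cross_ne_zero hrh (Γ.mem_region m' hm') hNe (by rwa [Γ.pos_σB hm'])
      (Γ.from_infinity m' hm') (Γ.asymptote m' hm')
  have hest : ∀ m' ∈ Ioc 0 m, m' / Γ.impactParameter m' ≤ δ₂ →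
      |Γ.impactParameter m' / rc - (1 + α * (m' / Γ.impactParameter m')
        + k * (m' / Γ.impactParameter m') ^ 2)| ≤ C₁ * (m' / Γ.impactParameter m') ^ 3 ∧
      |Γ.impactParameter m' / rc - 1| ≤ 1 / 2 := by
    intro m' hmm hw
    have hm' : m' ∈ Ioo 0 m₀ := ⟨hmm.1, hmm.2.trans_lt hm.2⟩
    have hb' := hb m' hm'
    obtain ⟨E, p, hray, hbp⟩ := hred m' hm'
    set b := Γ.impactParameter m' with hbdef
    set w := m' / b with hwdef
    have hw0 : 0 < w := div_pos hmm.1 hb'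
    have hw1 : w ≤ w₀ / 4 := hw.trans ((min_le_left _ _).trans (min_le_left _ _))
    have hw2 : w ≤ Real.sin (Real.arccos c / 2) / (16 * Real.pi * (M + 1)) :=
      hw.trans ((min_le_left _ _).trans (min_le_right _ _))
    have hw3 : w ≤ 1 := hw.trans ((min_le_right _ _).trans (min_le_left _ _))
    have hw4 : w ≤ 1 / (2 * (|α| + |k| + C₁ + 1)) :=
      hw.trans ((min_le_right _ _).trans (min_le_right _ _))
    rw [le_div_iff₀ (by positivity)] at hw2 hw4
    have hmB : m' / ‖xB‖ ≤ w₀ := by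
      rw [div_le_iff₀ hr0]
      calc m' ≤ m := hmm.2
        _ ≤ min w₀ (δ₂ / 4) * rc := hle
        _ ≤ w₀ * (‖xB‖ * 1) := by
          rw [hrc]
          gcongr
          exact min_le_left _ _
        _ = _ := by ring
    have key := hray.impact_bound (w₀ := w₀) (M := M) (K := K) (c := c) hmm.1 hrh (hreg m' hm')
      (Γ.mem_region m' hm') hNe (by rwa [Γ.pos_σB hm']) (by rw [Γ.pos_σB hm', hcc])
      (Γ.from_infinity m' hm') (Γ.asymptote m' hm') hM0 hK0 hF hM hK
      (by rwa [Γ.pos_σB hm']) (by rw [← hbp]; linarith)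
      (by
        rw [← hbp]
        refine le_trans ?_ hw2
        have : 0 ≤ 16 * Real.pi * w := by positivity
        linarith)
    rw [← hbp, Γ.pos_σB hm', ← hs, ← hwdef] at key
    have h1 : |b / rc - (1 + α * w + k * w ^ 2)| ≤ C₁ * w ^ 3 := by
      have e : b / rc - (1 + α * w + k * w ^ 2) = (b / ‖xB‖ - (s + (1 + P.γ) * w * (1 + c)
          + P.kappa * w ^ 2 * (s + (Real.pi - Real.arccos c) * c))) / s := by
        rw [hrc, hα, hk]
        field_simp
      rw [e, abs_div, abs_of_pos hs0, div_le_iff₀ hs0, hC₁]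
      refine key.trans (le_of_eq ?_)
      field_simp
    refine ⟨h1, ?_⟩
    have e : b / rc - 1 = (b / rc - (1 + α * w + k * w ^ 2)) + α * w + k * w ^ 2 := by ring
    rw [e]
    refine (abs_add_three _ _ _).trans ?_
    rw [abs_mul, abs_mul, abs_of_pos hw0, abs_of_pos (pow_pos hw0 2)]
    have h2 : w ^ 2 ≤ w := pow_le_of_le_one hw0.le hw3 (by norm_num)
    have h3 : w ^ 3 ≤ w := pow_le_of_le_one hw0.le hw3 (by norm_num)
    have h4 := mul_le_mul_of_nonneg_left h2 (abs_nonneg k)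
    have h5 := mul_le_mul_of_nonneg_left h3 hC₁0
    linarith
  -- Bootstrap in the mass: if the ratio exceeded `δ₂`, it would equal `δ₂` at some smaller mass
  -- `m'`. There the estimate gives `b ≥ r_c / 2`, hence `m' ≥ δ₂ r_c / 2`, against `m' ≤ δ₂ r_c /
  -- 4`.
  have hsmall : m / Γ.impactParameter m ≤ δ₂ := by
    obtain ⟨g, hgc, hg0, hg⟩ := Γ.exists_continuousOn_ratio hrh hreg hxB hb hm
    by_contra! hlt
    rw [← hg m ⟨hm.1, le_rfl⟩] at hlt
    obtain ⟨m', hm', hgm⟩ := intermediate_value_Icc hm.1.le hgc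
      (show δ₂ ∈ Icc (g 0) (g m) from ⟨by rw [hg0]; exact hδ₂0.le, hlt.le⟩)
    have hpos : 0 < m' := lt_of_le_of_ne hm'.1 fun h0 => by
      rw [← h0, hg0] at hgm
      exact hδ₂0.ne hgm
    rw [hg m' ⟨hpos, hm'.2⟩] at hgm
    have h1 := (abs_le.1 (hest m' ⟨hpos, hm'.2⟩ hgm.le).2).1
    have hb' := hb m' ⟨hpos, hm'.2.trans_lt hm.2⟩
    have h2 : 1 / 2 ≤ Γ.impactParameter m' / rc := by linarith
    rw [le_div_iff₀ hrc0] at h2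
    rw [div_eq_iff hb'.ne'] at hgm
    have h3 : m' ≤ δ₂ / 4 * rc := hm'.2.trans (hle.trans (by gcongr; exact min_le_right _ _))
    nlinarith
  obtain ⟨h1, h2⟩ := hest m ⟨hm.1, le_rfl⟩ hsmall
  have hbm := hb m hm
  have key := inversion_bound (μ := m / rc) (div_pos hm.1 hbm)
    (hsmall.trans ((min_le_right _ _).trans (min_le_left _ _))) (by field_simp) h2 hC₁0 h1
  rw [impactInfinity_eq hcc hss hs0 hsc hrc0.ne', ← hrcdef, ← hα, ← hk]
  have e : ∀ X : ℝ, Γ.impactParameter m - rc * X = rc * (Γ.impactParameter m / rc - X) :=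
    fun X => by field_simp
  rw [e, abs_mul, abs_of_pos hrc0]
  refine (mul_le_mul_of_nonneg_left key hrc0.le).trans (le_of_eq ?_)
  field_simp

end PotentialExpansion

/-! ### The theorem -/

/-- The functions `C` and `δ` depend on the expansion of the metric only; they are evaluated at the
cosine of the angle between `Ne` and `n_B`. -/
theorem proposition5 (P : PotentialExpansion) :
    ∃ C δ : ℝ → ℝ, (∀ c ∈ Ioo (-1 : ℝ) 1, 0 < δ c) ∧
      ∀ (rh m₀ : ℝ) (Ne xB : E3), 0 < rh → 0 < m₀ →
        (∀ m ∈ Ioo 0 m₀, P.RegularOutside m rh) →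
        ‖Ne‖ = 1 → cross Ne (unitDir xB) ≠ 0 →
        (∀ s : ℝ, s ≤ 0 → rh < ‖xB + s • Ne‖) →
        ∀ Γ : PotentialExpansion.QuasiMinkowskianRay P rh m₀ Ne xB, ∀ m ∈ Ioo 0 m₀,
          (∀ σ ≤ Γ.σB, Γ.L m σ = Γ.L m Γ.σB) ∧
          (m ≤ δ (inner ℝ Ne (unitDir xB)) * PotentialExpansion.rcInfinity Ne xB →
            |Γ.impactParameter m - P.impactInfinity m Ne xB|
              ≤ C (inner ℝ Ne (unitDir xB)) * (m ^ 3 / PotentialExpansion.rcInfinity Ne xB ^ 2)) ∧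
          Tendsto (fun σ => P.impactFinite m (Γ.pos m σ) xB) atBot
            (𝓝 (P.impactInfinity m Ne xB)) := by
  -- `C` and `δ` must be chosen before `r_h` and `m₀`, so `R` is taken from the series alone. If no
  -- such `R` exists, no regular metric exists and the claim is vacuous.
  by_cases H : ∃ R : ℝ, 0 < R ∧ (∀ w ∈ Ioo 0 R, Summable fun n : ℕ => P.a n * w ^ n) ∧
      ∀ w ∈ Ioo 0 R, Summable fun n : ℕ => P.e n * w ^ n
  · obtain ⟨R, hR, ha, he⟩ := H
    choose! C δ hδ hest using fun c (hc : c ∈ Ioo (-1 : ℝ) 1) =>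
      P.exists_impact_estimate hR ha he hc
    refine ⟨C, δ, hδ, fun rh m₀ Ne xB hrh _ hreg hNe hxB _ Γ m hm =>
      ⟨fun σ hσ => Γ.L_eq hrh hreg hm hσ, fun hle => ?_,
        tendsto_impactFinite P m hNe hxB (Γ.from_infinity m hm) (Γ.asymptote m hm)⟩⟩
    have hxB0 : xB ≠ 0 := by
      rw [← norm_pos_iff, ← Γ.pos_σB hm]
      exact hrh.trans (Γ.mem_region m hm Γ.σB self_mem_Iic)
    exact hest _ (inner_bounds_of_cross_ne_zero hNe (norm_unitDir hxB0) hxB) rh m₀ Ne xB hrh hreg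
      hNe hxB rfl Γ m hm hle
  · refine ⟨fun _ => 0, fun _ => 1, fun _ _ => one_pos,
      fun rh m₀ Ne xB hrh _ hreg _ _ _ Γ m hm => absurd ?_ H⟩
    exact ⟨m / rh, div_pos hm.1 hrh, fun w hw => ((hreg m hm).summable hrh hw).1,
      fun w hw => ((hreg m hm).summable hrh hw).2.1⟩
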